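/- Let $\theta,h,a>0$, $w\in\mathbb{R}$, and let $L:\mathbb{R}\to\mathbb{R}$ be such that $1-L(u)$ and $u\,(1-L(u))$ are Lebesgue integrable on $(0,\infty)$. Let $J_0$ be the Bessel function of the first kind of order zero and, for $y\in\mathbb{R}^2\setminus\{0\}$, put $$G_3(y)=\frac{1}{2\pi\theta}\Bigl(\frac{1}{|y|}-\frac1h\,\mathcal{F}\Bigl(\frac{|y|}{h}\Bigr)\Bigr),\qquad \mathcal{F}(t)=\int_0^\infty[1-L(u)]J_0(ut)\,du,$$ the surface influence function of an elastic layer of thickness $h$ bonded to an elastic half-space. Let the axisymmetric indenter $x_3=\Phi(|x|)$ satisfy $\Phi(0)=0$, with $x\mapsto\Phi(|x|)$ convex on a disc $\{|x|<b\}\subset\mathbb{R}^2$ for some $b>a$. Let $p$ be an axisymmetric contact pressure on $\omega=\{y\in\mathbb{R}^2:|y|<a\}$ solving the frictionless unilateral contact problem with indenter displacement $w$: $y\mapsto p(|y|)$ is integrable on $\omega$; for every $x\in\omega$ the following integral converges absolutely and $$\iint_\omega G_3(x-y)\,p(|y|)\,dy=w-\Phi(|x|);$$ $p(r)>0$ for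 $0\le r<a$; and $p(a)=0$, with $p$ continuous from the left at $a$. Define $$\mathcal{F}(\sigma,\tau)=\int_0^\infty[1-L(u)]J_0(\sigma u)J_0(\tau u)\,du,\qquad S_0(\sigma,\tau)=\int_0^\infty[1-L(u)]J_0(\sigma u)\cos(\tau u)\,du,$$ $$\frac{1}{2\pi}v(r)=\theta\bigl(w-\Phi(r)\bigr)+\frac1h\int_0^a\mathcal{F}\Bigl(\frac{\rho}{h},\frac rh\Bigr)p(\rho)\rho\,d\rho,\qquad \pi\mathcal{V}(r)=v(0)+r\int_0^r\frac{v'(s)\,ds}{\sqrt{r^2-s^2}}.$$ Then $\mathcal{V}(a)=0$, and the contact radius $a$ satisfies exactly $$w=a\int_0^a\frac{\Phi'(\rho)\,d\rho}{\sqrt{a^2-\rho^2}}-\frac{1}{\theta h}\int_0^a S_0\Bigl(\frac{\rho}{h},\frac ah\Bigr)p(\rho)\rho\,d\rho,$$ where the integrals over $(0,a)$ of $v'(s)/\sqrt{a^2-s^2}$, $\Phi'(\rho)/\sqrt{a^2-\rho^2}$ and $S_0(\rho/h,a/h)p(\rho)\rho$ converge absolutely (the derivatives exist almost everywhere). -/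

import Mathlib

open MeasureTheory Set

noncomputable section

namespace LayerContact

/-- The Bessel function of the first kind of order zero, as Bessel's integral
`J₀(x) = (1/π) ∫₀^π cos (x sin t) dt`. -/
def besselJ0 (x : ℝ) : ℝ :=
  (1 / Real.pi) * ∫ t in (0 : ℝ)..Real.pi, Real.cos (x * Real.sin t)

/-- `𝓕(t) = ∫₀^∞ [1 - L(u)] J₀(u t) du`. -/
def layerF (L : ℝ → ℝ) (t : ℝ) : ℝ :=
  ∫ u in Ioi (0 : ℝ), (1 - L u) * besselJ0 (u * t)

/-- The surface influence function of the layer bonded to the half-space,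
`G₃(y) = (1 / (2πθ)) (1/|y| - (1/h) 𝓕(|y|/h))`. -/
def influence (L : ℝ → ℝ) (θ h : ℝ) (y : EuclideanSpace ℝ (Fin 2)) : ℝ :=
  1 / (2 * Real.pi * θ) * (1 / ‖y‖ - 1 / h * layerF L (‖y‖ / h))

/-- `p` is the radial profile of the contact pressure, over the disc of radius `a`, in the
frictionless unilateral axisymmetric contact problem for an indenter with surface
`x₃ = Φ(|x|)` and displacement `w`.  The pressure may be unbounded at the centre of the disc
(as it is for a cone); its total force is finite, and it vanishes continuously at the edge. -/
structure IsContactPressure (L : ℝ → ℝ) (θ h : ℝ) (Φ : ℝ → ℝ) (w a : ℝ) (p : ℝ → ℝ) :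
    Prop where
  force_finite : IntegrableOn (fun y : EuclideanSpace ℝ (Fin 2) => p ‖y‖) (Metric.ball 0 a)
  convergent : ∀ x ∈ Metric.ball (0 : EuclideanSpace ℝ (Fin 2)) a,
    IntegrableOn (fun y => influence L θ h (x - y) * p ‖y‖) (Metric.ball 0 a)
  contact_eq : ∀ x ∈ Metric.ball (0 : EuclideanSpace ℝ (Fin 2)) a,
    ∫ y in Metric.ball 0 a, influence L θ h (x - y) * p ‖y‖ = w - Φ ‖x‖
  pos : ∀ r, 0 ≤ r → r < a → 0 < p r
  edge_zero : p a = 0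
  edge_continuous : ContinuousWithinAt p (Iic a) a

/-- `𝓕(σ, τ) = ∫₀^∞ [1 - L(u)] J₀(σ u) J₀(τ u) du`. -/
def layerF2 (L : ℝ → ℝ) (σ τ : ℝ) : ℝ :=
  ∫ u in Ioi (0 : ℝ), (1 - L u) * besselJ0 (σ * u) * besselJ0 (τ * u)

/-- `S₀(σ, τ) = ∫₀^∞ [1 - L(u)] J₀(σ u) cos (τ u) du`. -/
def S0 (L : ℝ → ℝ) (σ τ : ℝ) : ℝ :=
  ∫ u in Ioi (0 : ℝ), (1 - L u) * besselJ0 (σ * u) * Real.cos (τ * u)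

/-- The auxiliary function
`v(r) = 2π (θ (w - Φ(r)) + (1/h) ∫₀^a 𝓕(ρ/h, r/h) p(ρ) ρ dρ)`. -/
def auxV (L : ℝ → ℝ) (θ h : ℝ) (Φ : ℝ → ℝ) (w a : ℝ) (p : ℝ → ℝ) (r : ℝ) : ℝ :=
  2 * Real.pi * (θ * (w - Φ r) +
    1 / h * ∫ ρ in (0 : ℝ)..a, layerF2 L (ρ / h) (r / h) * p ρ * ρ)

/-- The density `𝓥` of the general solution of the half-space contact equation:
`π 𝓥(r) = v(0) + r ∫₀^r v'(s) / √(r² - s²) ds`.  For a convex indenter `v'` exists at all but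
countably many points. -/
def calV (L : ℝ → ℝ) (θ h : ℝ) (Φ : ℝ → ℝ) (w a : ℝ) (p : ℝ → ℝ) (r : ℝ) : ℝ :=
  1 / Real.pi * (auxV L θ h Φ w a p 0 +
    r * ∫ s in (0 : ℝ)..r, deriv (auxV L θ h Φ w a p) s / √(r ^ 2 - s ^ 2))

end LayerContact

end

/-! Once the layer part of the kernel is moved to the other side, the contact equation says that
`v(|x|)` is the Newtonian potential `∫ p(|y|)/|x-y| dy` over the contact disc
(`IsContactPressure.potential`). The layer part becomes the integral of `𝓕(ρ/h, r/h)` because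
Neumann's addition theorem evaluates the angular average of `J₀`.

This equation is tested against the density `1/√(r²-|x|²)` on the disc of radius `r ≤ a`. The
potential of that density is `π²` inside its disc and at most `π²` everywhere, since each chord
through the point contributes `π` (`two_mul_discPotential`). With `A(r) = ∫₀^r s v(s)/√(r²-s²) ds`,
Tonelli gives `2π A(r)` as the integral of `p` against this potential. Hence `0 ≤ A(a) - A(r) ≤
(π/2) · (mass of p on r ≤ |y| < a)`, and the mass is `o(a-r)` because `p` tends to zero at the edge.
So `A'(a) = 0`. On the other hand `A'(a) = v(0) + a ∫₀^a v'(s)/√(a²-s²) ds = π𝓥(a)`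
(`hasDerivAt_abel`). Thus `𝓥(a) = 0` follows without inverting an Abel equation
(`abel_deriv_eq_zero`).

The formula for `w` is `𝓥(a) = 0` written out. The layer term is a superposition of functions
`J₀(kr)`, and the Abel operator sends each of them to `cos(ka)` (`one_add_integral_besselJ0Deriv`),
which turns `𝓕` into `S₀` (`abel_layerTerm`). Convexity makes `Φ` Lipschitz near the contact
interval and integrability of `u(1-L(u))` makes the layer term Lipschitz, so `v'` exists almost
everywhere and is bounded there. -/

namespace LayerContact

/-! ### Bounds and derivative of `J₀`. -/

/-- The derivative of the Bessel function `J₀`. -/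
noncomputable def besselJ0Deriv (x : ℝ) : ℝ :=
  (1 / Real.pi) * ∫ t in (0 : ℝ)..Real.pi, -(Real.sin t * Real.sin (x * Real.sin t))

lemma abs_mean_le_one {f : ℝ → ℝ} (hf : ∀ t, |f t| ≤ 1) :
    |(1 / Real.pi) * ∫ t in (0 : ℝ)..Real.pi, f t| ≤ 1 := by
  have h := intervalIntegral.norm_integral_le_of_norm_le_const (a := 0) (b := Real.pi) (f := f)
    (C := 1) fun x _ => hf x
  rw [Real.norm_eq_abs, one_mul, sub_zero, abs_of_pos Real.pi_pos] at h
  rw [abs_mul, abs_of_pos (by positivity), one_div, inv_mul_le_iff₀ Real.pi_pos, mul_one]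
  exact h

lemma abs_besselJ0_le_one (x : ℝ) : |besselJ0 x| ≤ 1 :=
  abs_mean_le_one fun _ => Real.abs_cos_le_one _

lemma abs_besselJ0Deriv_le_one (x : ℝ) : |besselJ0Deriv x| ≤ 1 := by
  refine abs_mean_le_one fun t => ?_
  rw [abs_neg, abs_mul]
  exact mul_le_one₀ (Real.abs_sin_le_one _) (abs_nonneg _) (Real.abs_sin_le_one _)

lemma besselJ0_zero : besselJ0 0 = 1 := by
  simp [besselJ0, Real.pi_ne_zero]

@[fun_prop]
lemma continuous_besselJ0 : Continuous besselJ0 := by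
  unfold besselJ0
  refine continuous_const.mul ?_
  apply intervalIntegral.continuous_parametric_intervalIntegral_of_continuous' (by fun_prop)

@[fun_prop]
lemma continuous_besselJ0Deriv : Continuous besselJ0Deriv := by
  unfold besselJ0Deriv
  refine continuous_const.mul ?_
  apply intervalIntegral.continuous_parametric_intervalIntegral_of_continuous' (by fun_prop)

lemma hasDerivAt_besselJ0 (x : ℝ) : HasDerivAt besselJ0 (besselJ0Deriv x) x := by
  refine HasDerivAt.const_mul _ ?_
  refine (intervalIntegral.hasDerivAt_integral_of_dominated_loc_of_deriv_le
    (F := fun x t => Real.cos (x * Real.sin t))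
    (F' := fun x t => -(Real.sin t * Real.sin (x * Real.sin t))) (bound := fun _ => 1)
    (s := univ) Filter.univ_mem ?_ ?_ ?_ ?_ ?_ ?_).2
  · exact Filter.Eventually.of_forall fun y =>
      (by fun_prop : Continuous fun t => Real.cos (y * Real.sin t)).aestronglyMeasurable
  · exact (by fun_prop : Continuous fun t => Real.cos (x * Real.sin t)).intervalIntegrable _ _
  · exact (by fun_prop : Continuous fun t =>
      -(Real.sin t * Real.sin (x * Real.sin t))).aestronglyMeasurable
  · refine Filter.Eventually.of_forall fun t _ y _ => ?_
    rw [norm_neg, norm_mul]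
    exact mul_le_one₀ (Real.abs_sin_le_one _) (norm_nonneg _) (Real.abs_sin_le_one _)
  · exact intervalIntegrable_const
  · refine Filter.Eventually.of_forall fun t _ y _ => ?_
    have := ((hasDerivAt_id y).mul_const (Real.sin t)).cos
    refine this.congr_deriv ?_
    simp only [id_eq, one_mul]
    ring

lemma lipschitzWith_besselJ0 : LipschitzWith 1 besselJ0 :=
  lipschitzWith_of_nnnorm_deriv_le (fun x => (hasDerivAt_besselJ0 x).differentiableAt) fun x => by
    rw [(hasDerivAt_besselJ0 x).deriv]
    exact abs_besselJ0Deriv_le_one x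

/-! ### Power series of `J₀` and Sonine's integral. -/

lemma integral_zero_pi_eq_two_mul {f : ℝ → ℝ} (hf : Continuous f)
    (h : ∀ t, f (Real.pi - t) = f t) :
    ∫ t in (0 : ℝ)..Real.pi, f t = 2 * ∫ t in (0 : ℝ)..(Real.pi / 2), f t := by
  have h1 := intervalIntegral.integral_comp_sub_left (a := 0) (b := Real.pi / 2) f Real.pi
  simp only [h] at h1
  rw [← intervalIntegral.integral_add_adjacent_intervals (b := Real.pi / 2)
    (hf.intervalIntegrable _ _) (hf.intervalIntegrable _ _), h1]
  rw [sub_zero, show Real.pi - Real.pi / 2 = Real.pi / 2 by ring] at *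
  rw [← h1]; ring

/-- Termwise integration of an even power series with cosine-like coefficients against powers
of the sine. -/
lemma hasSum_integral_comp_mul_sin {c : ℕ → ℝ} (hc : ∀ k, |c k| ≤ 1) {f : ℝ → ℝ} {x : ℝ}
    (hf : ∀ y, HasSum (fun k => (-1) ^ k * y ^ (2 * k) / (2 * k).factorial * c k) (f y)) (j : ℕ) :
    HasSum (fun k => (-1) ^ k * x ^ (2 * k) / (2 * k).factorial * c k *
        ∫ t in (0 : ℝ)..Real.pi, Real.sin t ^ (2 * k + j))
      (∫ t in (0 : ℝ)..Real.pi, f (x * Real.sin t) * Real.sin t ^ j) := by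
  have hs : Summable fun k : ℕ => |x| ^ (2 * k) / ((2 * k).factorial : ℝ) :=
    (Real.summable_pow_div_factorial |x|).comp_injective
      (fun a b h => by simpa using h : Function.Injective fun k : ℕ => 2 * k)
  have := intervalIntegral.hasSum_integral_of_dominated_convergence (a := 0) (b := Real.pi)
    (μ := volume)
    (F := fun k t => (-1) ^ k * (x * Real.sin t) ^ (2 * k) / (2 * k).factorial * c k *
      Real.sin t ^ j) (f := fun t => f (x * Real.sin t) * Real.sin t ^ j)
    (fun k _ => |x| ^ (2 * k) / (2 * k).factorial) ?_ ?_ ?_ ?_ ?_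
  · refine Eq.mp (congrArg (HasSum · _) (funext fun k => ?_)) this
    rw [← intervalIntegral.integral_const_mul]
    congr 1; ext t; rw [mul_pow]; ring
  · exact fun k => (by fun_prop : Continuous fun t : ℝ => (-1) ^ k * (x * Real.sin t) ^ (2 * k) /
      (2 * k).factorial * c k * Real.sin t ^ j).aestronglyMeasurable
  · refine fun k => Filter.Eventually.of_forall fun t _ => ?_
    have h1 : |Real.sin t| ^ (2 * k) ≤ 1 := pow_le_one₀ (abs_nonneg _) (Real.abs_sin_le_one _)
    have h2 : |Real.sin t| ^ j ≤ 1 := pow_le_one₀ (abs_nonneg _) (Real.abs_sin_le_one _)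
    simp only [norm_mul, norm_div, norm_pow, norm_neg, norm_one, one_pow, one_mul, mul_pow,
      Real.norm_eq_abs, Nat.abs_cast]
    calc _ = |x| ^ (2 * k) / (2 * k).factorial * (|Real.sin t| ^ (2 * k) * |c k| *
            |Real.sin t| ^ j) := by ring
      _ ≤ |x| ^ (2 * k) / (2 * k).factorial * 1 := by
          gcongr
          exact mul_le_one₀ (mul_le_one₀ h1 (abs_nonneg _) (hc k)) (by positivity) h2
      _ = _ := mul_one _
  · exact Filter.Eventually.of_forall fun t _ => hs
  · exact intervalIntegrable_const
  · exact Filter.Eventually.of_forall fun t _ => (hf _).mul_right _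

lemma hasSum_besselJ0 (x : ℝ) :
    HasSum (fun k => (-1) ^ k * x ^ (2 * k) / (2 * k).factorial *
      ∏ i ∈ Finset.range k, (2 * (i : ℝ) + 1) / (2 * i + 2)) (besselJ0 x) := by
  have := (hasSum_integral_comp_mul_sin (c := fun _ => 1) (by simp) (x := x)
    (fun y => by simpa using Real.hasSum_cos y) 0).mul_left (1 / Real.pi)
  simp only [pow_zero, mul_one, add_zero, integral_sin_pow_even] at this
  refine Eq.mp (congrArg (HasSum · _) (funext fun k => ?_)) this
  have := Real.pi_ne_zero
  field_simp

/-- The first product comes from the Taylor coefficients of `J₀`, the second from integrals of odd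
powers of sine. Their telescoping converts the factor `1/(2k)!` into the `1/(2k+1)!` of the sine
series. -/
lemma prod_wallis_mul (k : ℕ) :
    (∏ i ∈ Finset.range k, (2 * (i : ℝ) + 1) / (2 * i + 2)) *
      ∏ i ∈ Finset.range k, (2 * (i : ℝ) + 2) / (2 * i + 3) = 1 / (2 * k + 1) := by
  induction k with
  | zero => simp
  | succ k ih =>
    rw [Finset.prod_range_succ, Finset.prod_range_succ, mul_mul_mul_comm, ih]
    push_cast
    field_simp
    ring

/-- Sonine's first integral in its simplest case. -/
lemma mul_integral_besselJ0_mul_sin (c : ℝ) :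
    c * ∫ t in (0 : ℝ)..(Real.pi / 2), besselJ0 (c * Real.sin t) * Real.sin t = Real.sin c := by
  have hb (k : ℕ) : |∏ i ∈ Finset.range k, (2 * (i : ℝ) + 1) / (2 * i + 2)| ≤ 1 := by
    rw [Finset.abs_prod]
    refine Finset.prod_le_one (fun _ _ => abs_nonneg _) fun i _ => ?_
    rw [abs_of_nonneg (by positivity), div_le_one (by positivity)]
    linarith
  -- The factor is `c / 2` rather than `c` because the series is integrated over `[0, π]`, twice the
  -- range of the statement.
  have h1 := (hasSum_integral_comp_mul_sin hb (x := c) hasSum_besselJ0 1).mul_left (c / 2)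
  have h2 : HasSum (fun k : ℕ => c / 2 * ((-1) ^ k * c ^ (2 * k) / (2 * k).factorial *
      (∏ i ∈ Finset.range k, (2 * (i : ℝ) + 1) / (2 * i + 2)) *
        ∫ t in (0 : ℝ)..Real.pi, Real.sin t ^ (2 * k + 1))) (Real.sin c) := by
    refine Eq.mp (congrArg (HasSum · _) (funext fun k => ?_)) (Real.hasSum_sin c)
    rw [integral_sin_pow_odd, mul_assoc (_ / _), mul_left_comm (∏ i ∈ _, _) 2, prod_wallis_mul,
      Nat.factorial_succ]
    push_cast
    field_simp
    ring
  rw [← h1.unique h2]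
  simp only [pow_one]
  rw [integral_zero_pi_eq_two_mul (f := fun t => besselJ0 (c * Real.sin t) * Real.sin t)
    (by fun_prop) (by simp)]
  ring

/-! ### The substitution `s = a sin t`. -/

lemma image_mul_sin_Ioo {a : ℝ} (ha : 0 < a) :
    (fun t => a * Real.sin t) '' Ioo 0 (Real.pi / 2) = Ioo 0 a := by
  ext s
  constructor
  · rintro ⟨t, ht, rfl⟩
    have h1 : 0 < Real.sin t := Real.sin_pos_of_pos_of_lt_pi ht.1 (by linarith [ht.2, Real.pi_pos])
    have h2 : Real.sin t < 1 := by
      rw [← Real.sin_pi_div_two]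
      exact Real.sin_lt_sin_of_lt_of_le_pi_div_two (by linarith [ht.1, Real.pi_pos]) le_rfl ht.2
    exact ⟨by positivity, by nlinarith⟩
  · rintro ⟨h0, h1⟩
    have h2 : 0 < s / a := by positivity
    have h3 : s / a < 1 := (div_lt_one ha).2 h1
    refine ⟨Real.arcsin (s / a), ⟨Real.arcsin_pos.2 h2, Real.arcsin_lt_pi_div_two.2 h3⟩, ?_⟩
    simp only
    rw [Real.sin_arcsin (by linarith) h3.le]
    field_simp

lemma injOn_mul_sin_Ioo {a : ℝ} (ha : 0 < a) :
    InjOn (fun t => a * Real.sin t) (Ioo 0 (Real.pi / 2)) := by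
  intro x hx y hy hxy
  have := Real.pi_pos
  exact Real.injOn_sin ⟨by linarith [hx.1], hx.2.le⟩ ⟨by linarith [hy.1], hy.2.le⟩
    (mul_left_cancel₀ ha.ne' hxy)

/-- The Jacobian `a cos t` equals `√(a² - s²)`, so the substitution removes the endpoint
singularity. -/
lemma abs_smul_div_sqrt_sin {a : ℝ} (ha : 0 < a) (f : ℝ → ℝ) {t : ℝ}
    (ht : t ∈ Ioo 0 (Real.pi / 2)) :
    |a * Real.cos t| • (f (a * Real.sin t) / √(a ^ 2 - (a * Real.sin t) ^ 2)) =
      f (a * Real.sin t) := by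
  have hc : 0 < a * Real.cos t :=
    mul_pos ha (Real.cos_pos_of_mem_Ioo ⟨by linarith [ht.1, Real.pi_pos], ht.2⟩)
  have : a ^ 2 - (a * Real.sin t) ^ 2 = (a * Real.cos t) ^ 2 := by
    rw [mul_pow, mul_pow, Real.cos_sq']; ring
  rw [this, Real.sqrt_sq hc.le, abs_of_pos hc, smul_eq_mul, mul_div_cancel₀ _ hc.ne']

lemma hasDerivWithinAt_mul_sin (a t : ℝ) (s : Set ℝ) :
    HasDerivWithinAt (fun t => a * Real.sin t) (a * Real.cos t) s t :=
  ((Real.hasDerivAt_sin t).const_mul a).hasDerivWithinAt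

/-- The substitution `s = a sin t` in an Abel integral. -/
lemma integral_div_sqrt_sq_sub_sq {a : ℝ} (ha : 0 < a) (f : ℝ → ℝ) :
    ∫ s in (0 : ℝ)..a, f s / √(a ^ 2 - s ^ 2) =
      ∫ t in (0 : ℝ)..(Real.pi / 2), f (a * Real.sin t) := by
  rw [intervalIntegral.integral_of_le ha.le, intervalIntegral.integral_of_le (by positivity),
    integral_Ioc_eq_integral_Ioo, integral_Ioc_eq_integral_Ioo, ← image_mul_sin_Ioo ha,
    integral_image_eq_integral_abs_deriv_smul measurableSet_Ioo
      (fun t _ => hasDerivWithinAt_mul_sin a t _) (injOn_mul_sin_Ioo ha)]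
  exact setIntegral_congr_fun measurableSet_Ioo fun t ht => abs_smul_div_sqrt_sin ha f ht

lemma intervalIntegrable_div_sqrt_sq_sub_sq {a : ℝ} (ha : 0 < a) (f : ℝ → ℝ) :
    IntervalIntegrable (fun s => f s / √(a ^ 2 - s ^ 2)) volume 0 a ↔
      IntervalIntegrable (fun t => f (a * Real.sin t)) volume 0 (Real.pi / 2) := by
  rw [intervalIntegrable_iff_integrableOn_Ioo_of_le ha.le,
    intervalIntegrable_iff_integrableOn_Ioo_of_le (by positivity), ← image_mul_sin_Ioo ha,
    integrableOn_image_iff_integrableOn_abs_deriv_smul measurableSet_Ioo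
      (fun t _ => hasDerivWithinAt_mul_sin a t _) (injOn_mul_sin_Ioo ha)]
  exact integrableOn_congr_fun (fun t ht => abs_smul_div_sqrt_sin ha f ht) measurableSet_Ioo

/-- The exceptional set in `t` lies in the image of the one in `s` under `arcsin (s / a)`, which is
differentiable on the open interval and so preserves null sets. This carries almost everywhere
differentiability through the substitution. -/
lemma ae_comp_mul_sin {a : ℝ} (ha : 0 < a) {P : ℝ → Prop} (hP : ∀ᵐ s, s ∈ Ioo 0 a → P s) :
    ∀ᵐ t, t ∈ Ioo 0 (Real.pi / 2) → P (a * Real.sin t) := by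
  rw [ae_iff] at hP ⊢
  have hsub : {s | ¬(s ∈ Ioo 0 a → P s)} ⊆ Ioo 0 a := fun s hs => by
    simp only [mem_ofPred_eq, Classical.not_imp] at hs; exact hs.1
  have h := addHaar_image_eq_zero_of_differentiableOn_of_addHaar_eq_zero volume
    (f := fun s => Real.arcsin (s / a)) (s := {s | ¬(s ∈ Ioo 0 a → P s)}) (fun s hs => by
      have hs' := hsub hs
      have h2 : 0 < s / a := div_pos hs'.1 ha
      have h3 : s / a < 1 := (div_lt_one ha).2 hs'.2
      exact ((Real.differentiableAt_arcsin.2 ⟨by linarith, h3.ne⟩).comp s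
        (differentiableAt_id.div_const a)).differentiableWithinAt) hP
  refine measure_mono_null (fun t ht => ?_) h
  simp only [mem_ofPred_eq, Classical.not_imp] at ht
  refine ⟨a * Real.sin t, ?_, ?_⟩
  · simp only [mem_ofPred_eq, Classical.not_imp]
    exact ⟨image_mul_sin_Ioo ha ▸ mem_image_of_mem _ ht.1, ht.2⟩
  · have := Real.pi_pos
    simp only
    rw [mul_div_cancel_left₀ _ ha.ne', Real.arcsin_sin (by linarith [ht.1.1]) ht.1.2.le]

lemma ae_Ioc_of_ae_Ioo {a b : ℝ} {P : ℝ → Prop} (h : ∀ᵐ t, t ∈ Ioo a b → P t) :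
    ∀ᵐ t, t ∈ Ioc a b → P t := by
  filter_upwards [h, compl_mem_ae_iff.2 (measure_singleton b)] with t ht hb hm
  exact ht ⟨hm.1, lt_of_le_of_ne hm.2 hb⟩

/-! ### The Abel transform of a Lipschitz function. -/

section Abel

variable {V : ℝ → ℝ} {K : NNReal} (hV : LipschitzWith K V) {a : ℝ} (ha : 0 < a)
include hV ha

lemma ae_hasDerivAt_comp_mul_sin :
    ∀ᵐ t, t ∈ Ioc 0 (Real.pi / 2) → HasDerivAt V (deriv V (a * Real.sin t)) (a * Real.sin t) := by
  refine ae_Ioc_of_ae_Ioo (ae_comp_mul_sin ha (P := fun s => HasDerivAt V (deriv V s) s) ?_)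
  filter_upwards [hV.ae_differentiableAt_real] with s hs _
  exact hs.hasDerivAt

omit ha in
lemma intervalIntegrable_mul_deriv_comp_mul_sin {g : ℝ → ℝ} (hg : Continuous g) (b c : ℝ) :
    IntervalIntegrable (fun t => g t * deriv V (a * Real.sin t)) volume b c := by
  rw [intervalIntegrable_iff]
  refine (intervalIntegrable_iff.1 (hg.intervalIntegrable b c)).mul_bdd (c := K) ?_ ?_
  · exact ((measurable_deriv V).comp (by fun_prop)).aestronglyMeasurable
  · exact Filter.Eventually.of_forall fun t => norm_deriv_le_of_lipschitz hV

/-- Integration by parts with `sin = -cos'`, valid for absolutely continuous functions. The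
resulting `cos²` complements the `sin²` that arises on differentiating the Abel transform in `r`. -/
lemma integral_comp_mul_sin_mul_sin :
    ∫ t in (0 : ℝ)..(Real.pi / 2), V (a * Real.sin t) * Real.sin t =
      V 0 + ∫ t in (0 : ℝ)..(Real.pi / 2), a * Real.cos t ^ 2 * deriv V (a * Real.sin t) := by
  have hf : AbsolutelyContinuousOnInterval (fun t => V (a * Real.sin t)) 0 (Real.pi / 2) := by
    have h1 : LipschitzWith (K * (‖a‖₊ * 1)) fun t => V (a * Real.sin t) :=
      hV.comp ((lipschitzWith_smul a).comp Real.lipschitzWith_sin)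
    exact (h1.lipschitzOnWith).absolutelyContinuousOnInterval
  have hg : AbsolutelyContinuousOnInterval Real.cos 0 (Real.pi / 2) :=
    (Real.lipschitzWith_cos.lipschitzOnWith).absolutelyContinuousOnInterval
  have h := hf.integral_mul_deriv_eq_deriv_mul hg
  simp only [Real.deriv_cos, mul_neg, Real.cos_pi_div_two, Real.sin_zero, mul_zero, Real.cos_zero,
    mul_one, zero_sub, intervalIntegral.integral_neg] at h
  have h2 : ∫ t in (0 : ℝ)..(Real.pi / 2), deriv (fun t => V (a * Real.sin t)) t * Real.cos t =
      ∫ t in (0 : ℝ)..(Real.pi / 2), a * Real.cos t ^ 2 * deriv V (a * Real.sin t) := by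
    refine intervalIntegral.integral_congr_ae ?_
    filter_upwards [ae_hasDerivAt_comp_mul_sin hV ha] with t ht hm
    rw [uIoc_of_le (by positivity)] at hm
    have h3 : HasDerivAt (fun t => V (a * Real.sin t)) _ t :=
      (ht hm).comp t ((Real.hasDerivAt_sin t).const_mul a)
    rw [h3.deriv]
    ring
  rw [h2] at h
  linarith

/-- Differentiation of the Abel transform `r ↦ ∫₀^r s V(s) / √(r² - s²) ds` of a Lipschitz
function. -/
lemma hasDerivAt_abel :
    HasDerivAt (fun r => ∫ t in (0 : ℝ)..(Real.pi / 2), r * V (r * Real.sin t) * Real.sin t)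
      (V 0 + a * ∫ t in (0 : ℝ)..(Real.pi / 2), deriv V (a * Real.sin t)) a := by
  have hVc := hV.continuous
  have h := (intervalIntegral.hasDerivAt_integral_of_dominated_loc_of_lip (μ := volume)
    (a := 0) (b := Real.pi / 2) (x₀ := a)
    (F := fun r t => r * V (r * Real.sin t) * Real.sin t)
    (F' := fun t => V (a * Real.sin t) * Real.sin t +
      a * Real.sin t ^ 2 * deriv V (a * Real.sin t))
    -- For `|r - a| < 1` one has `|r sin t| ≤ a + 1`, hence `|V| ≤ |V 0| + K(a + 1)`. The second
    -- `K(a + 1)` comes from varying `V` while the factor `r` is held.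
    (s := Metric.ball a 1) (bound := fun _ => |V 0| + 2 * (K * (a + 1)))
    (Metric.ball_mem_nhds a one_pos) ?_ ?_ ?_ ?_ intervalIntegrable_const ?_).2
  · refine h.congr_deriv ?_
    rw [intervalIntegral.integral_add
      ((by fun_prop : Continuous fun t => V (a * Real.sin t) * Real.sin t).intervalIntegrable _ _)
      (intervalIntegrable_mul_deriv_comp_mul_sin hV (by fun_prop) _ _),
      integral_comp_mul_sin_mul_sin hV ha, add_assoc, ← intervalIntegral.integral_add
      (intervalIntegrable_mul_deriv_comp_mul_sin hV (by fun_prop) _ _)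
      (intervalIntegrable_mul_deriv_comp_mul_sin hV (by fun_prop) _ _),
      ← intervalIntegral.integral_const_mul]
    congr 2
    ext t
    rw [← add_mul, ← mul_add, Real.cos_sq_add_sin_sq, mul_one]
  · exact Filter.Eventually.of_forall fun r => (by fun_prop : Continuous fun t =>
      r * V (r * Real.sin t) * Real.sin t).aestronglyMeasurable
  · exact (by fun_prop : Continuous fun t =>
      a * V (a * Real.sin t) * Real.sin t).intervalIntegrable _ _
  · exact (Measurable.add (by fun_prop) (Measurable.mul (by fun_prop)
      ((measurable_deriv V).comp (by fun_prop)))).aestronglyMeasurable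
  · refine Filter.Eventually.of_forall fun t _ => ?_
    have hK : (0 : ℝ) ≤ K := K.2
    have hb : 0 ≤ |V 0| + 2 * (K * (a + 1)) := by positivity
    refine LipschitzOnWith.of_dist_le_mul fun r hr q hq => ?_
    rw [Real.coe_nnabs, abs_of_nonneg hb, Real.dist_eq, Real.dist_eq]
    rw [Metric.mem_ball, Real.dist_eq, abs_lt] at hr hq
    have hs := Real.abs_sin_le_one t
    have e1 : |V (r * Real.sin t) - V (q * Real.sin t)| ≤ K * |r - q| := by
      refine (hV.dist_le_mul _ _).trans ?_
      rw [Real.dist_eq, ← sub_mul, abs_mul]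
      gcongr
      exact mul_le_of_le_one_right (abs_nonneg _) hs
    have e2 : |V (r * Real.sin t)| ≤ |V 0| + K * (a + 1) := by
      have h1 := hV.dist_le_mul (r * Real.sin t) 0
      rw [Real.dist_eq, Real.dist_eq, sub_zero, abs_mul] at h1
      have h2 : |r| * |Real.sin t| ≤ (a + 1) * 1 := by
        gcongr
        rw [abs_le]; constructor <;> linarith
      have h3 : (K : ℝ) * (|r| * |Real.sin t|) ≤ K * ((a + 1) * 1) := by gcongr
      have h4 := abs_sub_abs_le_abs_sub (V (r * Real.sin t)) (V 0)
      linarith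
    have e3 : |q| ≤ a + 1 := by rw [abs_le]; constructor <;> linarith
    calc |r * V (r * Real.sin t) * Real.sin t - q * V (q * Real.sin t) * Real.sin t|
        = |(r - q) * V (r * Real.sin t) + q * (V (r * Real.sin t) - V (q * Real.sin t))| *
            |Real.sin t| := by rw [← abs_mul]; ring_nf
      _ ≤ (|r - q| * (|V 0| + K * (a + 1)) + (a + 1) * (K * |r - q|)) * 1 := by
          gcongr
          refine (abs_add_le _ _).trans ?_
          rw [abs_mul, abs_mul]
          gcongr
      _ = _ := by ring
  · filter_upwards [ae_hasDerivAt_comp_mul_sin hV ha] with t ht hm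
    rw [uIoc_of_le (by positivity)] at hm
    have h1 : HasDerivAt (fun r => V (r * Real.sin t))
        (deriv V (a * Real.sin t) * (1 * Real.sin t)) a :=
      (ht hm).comp a ((hasDerivAt_id a).mul_const (Real.sin t))
    refine (((hasDerivAt_id a).mul h1).mul_const (Real.sin t)).congr_deriv ?_
    simp only [id_eq]
    ring

end Abel

/-- The Abel transform of `J₀` in differentiated form. -/
lemma one_add_integral_besselJ0Deriv {a : ℝ} (ha : 0 < a) (k : ℝ) :
    1 + a * ∫ t in (0 : ℝ)..(Real.pi / 2), k * besselJ0Deriv (k * (a * Real.sin t)) =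
      Real.cos (k * a) := by
  have hd (s : ℝ) : HasDerivAt (fun s => besselJ0 (k * s)) (k * besselJ0Deriv (k * s)) s := by
    refine ((hasDerivAt_besselJ0 (k * s)).comp s ((hasDerivAt_id s).const_mul k)).congr_deriv ?_
    simp only [mul_one]
    ring
  have hL : LipschitzWith (1 * ‖k‖₊) fun s => besselJ0 (k * s) :=
    lipschitzWith_besselJ0.comp (lipschitzWith_smul k)
  have h1 := hasDerivAt_abel hL ha
  simp only [(hd _).deriv, mul_zero, besselJ0_zero] at h1
  have h2 : HasDerivAt (fun r => ∫ t in (0 : ℝ)..(Real.pi / 2),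
      r * besselJ0 (k * (r * Real.sin t)) * Real.sin t) (Real.cos (k * a)) a := by
    -- Sonine's integral gives the transform as `sin(kr)/k`, so `k = 0` is separate.
    rcases eq_or_ne k 0 with rfl | hk
    · simp only [zero_mul, besselJ0_zero, mul_one, intervalIntegral.integral_const_mul,
        integral_sin, Real.cos_zero, Real.cos_pi_div_two, sub_zero]
      exact hasDerivAt_id a
    · have : (fun r => ∫ t in (0 : ℝ)..(Real.pi / 2),
          r * besselJ0 (k * (r * Real.sin t)) * Real.sin t) = fun r => k⁻¹ * Real.sin (k * r) := by
        funext r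
        rw [← mul_integral_besselJ0_mul_sin (k * r)]
        simp only [mul_assoc, intervalIntegral.integral_const_mul]
        field_simp
      rw [this]
      refine (((hasDerivAt_id a).const_mul k).sin.const_mul k⁻¹).congr_deriv ?_
      simp only [id_eq, mul_one]
      field_simp
  exact h1.unique h2

/-! ### Polar coordinates in the Euclidean plane. -/

/-- The unit vector at polar angle `φ`. -/
noncomputable def unitVec (φ : ℝ) : EuclideanSpace ℝ (Fin 2) := !₂[Real.cos φ, Real.sin φ]

lemma norm_unitVec (φ : ℝ) : ‖unitVec φ‖ = 1 := by
  simp [unitVec, EuclideanSpace.norm_eq]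

lemma inner_unitVec (φ ψ : ℝ) : inner ℝ (unitVec φ) (unitVec ψ) = Real.cos (ψ - φ) := by
  simp [unitVec, PiLp.inner_apply, Real.cos_sub]

@[fun_prop]
lemma continuous_unitVec : Continuous unitVec := by
  unfold unitVec
  refine (PiLp.continuous_toLp 2 _).comp (continuous_pi fun i => ?_)
  fin_cases i
  · exact Real.continuous_cos
  · exact Real.continuous_sin

/-- The measurable identification of `ℝ × ℝ` with the Euclidean plane. -/
noncomputable def prodEquivPlane : ℝ × ℝ ≃ᵐ EuclideanSpace ℝ (Fin 2) :=
  (MeasurableEquiv.finTwoArrow (α := ℝ)).symm.trans (MeasurableEquiv.toLp 2 (Fin 2 → ℝ))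

lemma measurePreserving_prodEquivPlane : MeasurePreserving prodEquivPlane volume volume :=
  ((volume_preserving_finTwoArrow ℝ).symm).trans
    (EuclideanSpace.volume_preserving_symm_measurableEquiv_toLp (Fin 2)).symm

lemma prodEquivPlane_polarCoord_symm (q : ℝ × ℝ) :
    prodEquivPlane (polarCoord.symm q) = q.1 • unitVec q.2 := by
  ext i
  fin_cases i <;> simp [prodEquivPlane, unitVec, polarCoord, MeasurableEquiv.finTwoArrow]

lemma lintegral_plane_polar (f : EuclideanSpace ℝ (Fin 2) → ENNReal) :
    ∫⁻ x, f x = ∫⁻ q in Ioi (0 : ℝ) ×ˢ Ioo (-Real.pi) Real.pi,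
      ENNReal.ofReal q.1 * f (q.1 • unitVec q.2) := by
  rw [← measurePreserving_prodEquivPlane.lintegral_comp_emb prodEquivPlane.measurableEmbedding,
    ← lintegral_comp_polarCoord_symm]
  simp only [prodEquivPlane_polarCoord_symm, smul_eq_mul]
  rfl

lemma integral_plane_polar (f : EuclideanSpace ℝ (Fin 2) → ℝ) :
    ∫ x, f x = ∫ q in Ioi (0 : ℝ) ×ˢ Ioo (-Real.pi) Real.pi, q.1 * f (q.1 • unitVec q.2) := by
  rw [← measurePreserving_prodEquivPlane.integral_comp prodEquivPlane.measurableEmbedding,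
    ← integral_comp_polarCoord_symm]
  simp only [prodEquivPlane_polarCoord_symm, smul_eq_mul]
  rfl

/-! ### The potential of the disc, computed by chords. -/

/-- The integral of `1 / √(c - s²)` along a chord; the integrand vanishes off the chord. -/
lemma lintegral_one_div_sqrt_sub_sq {c : ℝ} (hc : 0 < c) :
    ∫⁻ s : ℝ, ENNReal.ofReal (1 / √(c - s ^ 2)) = ENNReal.ofReal Real.pi := by
  have hr : 0 < √c := Real.sqrt_pos.2 hc
  have hcc : √c ^ 2 = c := Real.sq_sqrt hc.le
  have himg : (fun t => √c * Real.sin t) '' Ioo (-(Real.pi / 2)) (Real.pi / 2) =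
      Ioo (-√c) √c := by
    ext s
    constructor
    · rintro ⟨t, ht, rfl⟩
      have h1 : -1 < Real.sin t := by
        rw [← Real.sin_pi_div_two, ← Real.sin_neg]
        exact Real.sin_lt_sin_of_lt_of_le_pi_div_two le_rfl ht.2.le ht.1
      have h2 : Real.sin t < 1 := by
        rw [← Real.sin_pi_div_two]
        exact Real.sin_lt_sin_of_lt_of_le_pi_div_two ht.1.le le_rfl ht.2
      constructor <;> simp only <;> nlinarith
    · rintro ⟨h0, h1⟩
      have h2 : -1 < s / √c := by rw [lt_div_iff₀ hr]; linarith
      have h3 : s / √c < 1 := (div_lt_one hr).2 h1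
      refine ⟨Real.arcsin (s / √c),
        ⟨Real.neg_pi_div_two_lt_arcsin.2 h2, Real.arcsin_lt_pi_div_two.2 h3⟩, ?_⟩
      simp only
      rw [Real.sin_arcsin h2.le h3.le]
      field_simp
  have hinj : InjOn (fun t => √c * Real.sin t) (Ioo (-(Real.pi / 2)) (Real.pi / 2)) :=
    fun x hx y hy hxy => Real.injOn_sin ⟨hx.1.le, hx.2.le⟩ ⟨hy.1.le, hy.2.le⟩
      (mul_left_cancel₀ hr.ne' hxy)
  have hsupp : (Function.support fun s : ℝ => ENNReal.ofReal (1 / √(c - s ^ 2))) ⊆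
      Ioo (-√c) √c := by
    intro s hs
    by_contra h
    apply hs
    have : c ≤ s ^ 2 := by
      rw [mem_Ioo, not_and_or, not_lt, not_lt] at h
      rw [← hcc]
      rcases h with h | h <;> nlinarith
    simp only
    -- The conventions `√x = 0` for `x ≤ 0` and `1 / 0 = 0` play the role of an indicator function.
    rw [Real.sqrt_eq_zero_of_nonpos (by linarith)]
    simp
  rw [← setLIntegral_eq_of_support_subset hsupp, ← himg,
    lintegral_image_eq_lintegral_abs_deriv_mul measurableSet_Ioo
      (fun t _ => hasDerivWithinAt_mul_sin (√c) t _) hinj]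
  have : ∀ t ∈ Ioo (-(Real.pi / 2)) (Real.pi / 2), ENNReal.ofReal |√c * Real.cos t| *
      ENNReal.ofReal (1 / √(c - (√c * Real.sin t) ^ 2)) = 1 := fun t ht => by
    have hp : 0 < √c * Real.cos t := mul_pos hr (Real.cos_pos_of_mem_Ioo ht)
    have : c - (√c * Real.sin t) ^ 2 = (√c * Real.cos t) ^ 2 := by
      rw [mul_pow, mul_pow, Real.cos_sq', hcc]; ring
    rw [this, Real.sqrt_sq hp.le, abs_of_pos hp, ← ENNReal.ofReal_mul hp.le,
      mul_one_div_cancel hp.ne', ENNReal.ofReal_one]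
  rw [setLIntegral_congr_fun measurableSet_Ioo this]
  simp [Real.volume_Ioo]

lemma lintegral_one_div_sqrt_sub_sq_le (c : ℝ) :
    ∫⁻ s : ℝ, ENNReal.ofReal (1 / √(c - s ^ 2)) ≤ ENNReal.ofReal Real.pi := by
  rcases lt_or_ge 0 c with h | h
  · exact (lintegral_one_div_sqrt_sub_sq h).le
  · have : ∀ s : ℝ, √(c - s ^ 2) = 0 := fun s =>
      Real.sqrt_eq_zero_of_nonpos (by nlinarith [sq_nonneg s])
    simp [this]

/-- Joins two opposite rays from a point into one full line. -/
lemma setLIntegral_Ioi_add_neg {f : ℝ → ENNReal} (hf : Measurable f) :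
    ∫⁻ s in Ioi (0 : ℝ), (f s + f (-s)) = ∫⁻ s, f s := by
  have h := (Measure.measurePreserving_neg (volume : Measure ℝ)).setLIntegral_comp_preimage
    (measurableSet_Iio (a := (0 : ℝ))) hf
  have hpre : (Neg.neg ⁻¹' Iio (0 : ℝ)) = Ioi 0 := by ext; simp
  rw [hpre] at h
  rw [lintegral_add_left hf, h, setLIntegral_congr Iio_ae_eq_Iic, ← compl_Ioi]
  exact lintegral_add_compl f measurableSet_Ioi

/-- The Newtonian potential at `y` of the density `1 / √(r² - |x|²)` on the disc of radius `r`;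
the integrand vanishes off the disc. -/
noncomputable def discPotential (r : ℝ) (y : EuclideanSpace ℝ (Fin 2)) : ENNReal :=
  ∫⁻ x, ENNReal.ofReal (1 / (‖x - y‖ * √(r ^ 2 - ‖x‖ ^ 2)))

/-- Completing the square: `s = -⟨y, e⟩` is the midpoint of the chord through `y` in direction `e`.
-/
lemma norm_add_smul_unitVec_sq (y : EuclideanSpace ℝ (Fin 2)) (s φ : ℝ) :
    ‖y + s • unitVec φ‖ ^ 2 =
      (s + inner ℝ y (unitVec φ)) ^ 2 + (‖y‖ ^ 2 - inner ℝ y (unitVec φ) ^ 2) := by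
  rw [norm_add_sq_real, inner_smul_right, norm_smul, norm_unitVec, mul_one, Real.norm_eq_abs,
    sq_abs]
  ring

/-- Twice the potential of the disc is an integral over all chords through the point. -/
lemma two_mul_discPotential (r : ℝ) (y : EuclideanSpace ℝ (Fin 2)) :
    2 * discPotential r y = ∫⁻ φ in Ioo (-Real.pi) Real.pi, ∫⁻ s : ℝ,
      ENNReal.ofReal (1 / √(r ^ 2 - ‖y‖ ^ 2 + inner ℝ y (unitVec φ) ^ 2 - s ^ 2)) := by
  set G : ℝ × ℝ → ENNReal := fun q =>
    ENNReal.ofReal (1 / √(r ^ 2 - ‖y + q.1 • unitVec q.2‖ ^ 2)) with hG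
  have hGm : Measurable G := by
    refine ENNReal.measurable_ofReal.comp (measurable_const.div ?_)
    exact (by fun_prop : Continuous fun q : ℝ × ℝ =>
      √(r ^ 2 - ‖y + q.1 • unitVec q.2‖ ^ 2)).measurable
  have hGm' : Measurable fun q : ℝ × ℝ => G (-q.1, q.2) :=
    hGm.comp (by fun_prop : Measurable fun q : ℝ × ℝ => (-q.1, q.2))
  -- In polar coordinates centred at `y` the Jacobian `s` cancels the Newtonian singularity.
  have key (s : ℝ) (hs : 0 < s) (φ A : ℝ) : ENNReal.ofReal s *
      ENNReal.ofReal (1 / (‖s • unitVec φ‖ * A)) = ENNReal.ofReal (1 / A) := by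
    rw [norm_smul, norm_unitVec, mul_one, Real.norm_of_nonneg hs.le, ← ENNReal.ofReal_mul hs.le]
    congr 1
    rw [one_div, one_div, mul_inv, mul_inv_cancel_left₀ hs.ne']
  have h1 : discPotential r y = ∫⁻ q in Ioi (0 : ℝ) ×ˢ Ioo (-Real.pi) Real.pi, G q := by
    rw [discPotential, ← lintegral_add_left_eq_self _ y, lintegral_plane_polar]
    refine setLIntegral_congr_fun (measurableSet_Ioi.prod measurableSet_Ioo) fun q hq => ?_
    simp only [add_sub_cancel_left]
    exact key q.1 hq.1 _ _
  -- The same integral with directions reversed. Adding it to `h1` completes rays to lines, whence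
  -- the factor two.
  have h2 : discPotential r y =
      ∫⁻ q in Ioi (0 : ℝ) ×ˢ Ioo (-Real.pi) Real.pi, G (-q.1, q.2) := by
    rw [discPotential, ← lintegral_sub_left_eq_self _ y, lintegral_plane_polar]
    refine setLIntegral_congr_fun (measurableSet_Ioi.prod measurableSet_Ioo) fun q hq => ?_
    simp only [sub_sub_cancel_left, norm_neg, hG, neg_smul, ← sub_eq_add_neg]
    exact key q.1 hq.1 _ _
  rw [two_mul]
  nth_rewrite 1 [h1]
  rw [h2, ← lintegral_add_left hGm, Measure.volume_eq_prod, ← Measure.prod_restrict,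
    lintegral_prod_symm (fun q => G q + G (-q.1, q.2)) (hGm.add hGm').aemeasurable]
  refine lintegral_congr fun φ => ?_
  rw [setLIntegral_Ioi_add_neg (f := fun s => G (s, φ))
    (hGm.comp (by fun_prop : Measurable fun s : ℝ => (s, φ)))]
  symm
  -- Translation to the midpoint of the chord.
  rw [← lintegral_add_right_eq_self _ (inner ℝ y (unitVec φ))]
  refine lintegral_congr fun s => ?_
  rw [hG]
  simp only [norm_add_smul_unitVec_sq]
  congr 3
  ring

lemma lintegral_const_pi_Ioo : ∫⁻ _ in Ioo (-Real.pi) Real.pi, ENNReal.ofReal Real.pi =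
    2 * ENNReal.ofReal (Real.pi ^ 2) := by
  rw [setLIntegral_const, Real.volume_Ioo, ← ENNReal.ofReal_mul Real.pi_pos.le,
    ← ENNReal.ofReal_ofNat 2, ← ENNReal.ofReal_mul (by norm_num)]
  ring_nf

lemma discPotential_le (r : ℝ) (y : EuclideanSpace ℝ (Fin 2)) :
    discPotential r y ≤ ENNReal.ofReal (Real.pi ^ 2) := by
  rw [← ENNReal.mul_le_mul_iff_right two_ne_zero ENNReal.ofNat_ne_top, two_mul_discPotential,
    ← lintegral_const_pi_Ioo]
  exact lintegral_mono fun φ => lintegral_one_div_sqrt_sub_sq_le _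

/-- For `y` inside the disc the constant `r² - |y|² + ⟨y, e⟩²` is positive in every direction, so
each chord contributes exactly `π`. -/
lemma discPotential_eq {r : ℝ} {y : EuclideanSpace ℝ (Fin 2)} (hy : ‖y‖ < r) :
    discPotential r y = ENNReal.ofReal (Real.pi ^ 2) := by
  rw [← ENNReal.mul_right_inj two_ne_zero ENNReal.ofNat_ne_top, two_mul_discPotential,
    ← lintegral_const_pi_Ioo]
  refine lintegral_congr fun φ => lintegral_one_div_sqrt_sub_sq ?_
  nlinarith [norm_nonneg y, sq_nonneg (inner ℝ y (unitVec φ))]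

/-! ### Angular averages and the addition theorem. -/

section Angular

lemma integral_comp_cos_sub (f : ℝ → ℝ) (α : ℝ) :
    ∫ φ in (-Real.pi)..Real.pi, f (Real.cos (φ - α)) =
      ∫ φ in (-Real.pi)..Real.pi, f (Real.sin φ) := by
  have hp : Function.Periodic (fun φ => f (Real.sin φ)) (2 * Real.pi) := fun φ => by
    simp only [Real.sin_add_two_pi]
  have h := intervalIntegral.integral_comp_add_right (a := -Real.pi) (b := Real.pi)
    (fun φ => f (Real.sin φ)) (Real.pi / 2 - α)
  have e (φ : ℝ) : Real.sin (φ + (Real.pi / 2 - α)) = Real.cos (φ - α) := by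
    rw [show φ + (Real.pi / 2 - α) = φ - α + Real.pi / 2 by ring, Real.sin_add_pi_div_two]
  simp only [e] at h
  rw [h, show Real.pi + (Real.pi / 2 - α) = -Real.pi + (Real.pi / 2 - α) + 2 * Real.pi by ring,
    hp.intervalIntegral_add_eq _ (-Real.pi)]
  congr 1
  ring

lemma integral_cos_mul_cos_sub (c α : ℝ) :
    ∫ φ in (-Real.pi)..Real.pi, Real.cos (c * Real.cos (φ - α)) =
      2 * Real.pi * besselJ0 c := by
  have hc : Continuous fun φ => Real.cos (c * Real.sin φ) := by fun_prop
  rw [integral_comp_cos_sub (fun s => Real.cos (c * s)),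
    ← intervalIntegral.integral_add_adjacent_intervals (b := 0)
      (hc.intervalIntegrable _ _) (hc.intervalIntegrable _ _)]
  have h := intervalIntegral.integral_comp_neg (a := 0) (b := Real.pi)
    fun φ => Real.cos (c * Real.sin φ)
  simp only [Real.sin_neg, mul_neg, Real.cos_neg, neg_zero] at h
  rw [← h, besselJ0]
  field_simp
  ring

lemma integral_sin_mul_cos_sub (c α : ℝ) :
    ∫ φ in (-Real.pi)..Real.pi, Real.sin (c * Real.cos (φ - α)) = 0 := by
  rw [integral_comp_cos_sub (fun s => Real.sin (c * s))]
  have h := intervalIntegral.integral_comp_neg (a := -Real.pi) (b := Real.pi)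
    fun φ => Real.sin (c * Real.sin φ)
  simp only [Real.sin_neg, mul_neg, neg_neg, intervalIntegral.integral_neg] at h
  linarith

lemma exists_eq_norm_smul_unitVec (z : EuclideanSpace ℝ (Fin 2)) :
    ∃ α, z = ‖z‖ • unitVec α := by
  have hn : ‖(⟨z 0, z 1⟩ : ℂ)‖ = ‖z‖ := by
    rw [Complex.norm_def, Complex.normSq_mk, EuclideanSpace.norm_eq]
    simp [← sq]
  refine ⟨Complex.arg ⟨z 0, z 1⟩, ?_⟩
  ext i
  fin_cases i
  · simpa [unitVec, hn] using (Complex.norm_mul_cos_arg ⟨z 0, z 1⟩).symm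
  · simpa [unitVec, hn] using (Complex.norm_mul_sin_arg ⟨z 0, z 1⟩).symm

lemma integral_cos_inner_unitVec (z : EuclideanSpace ℝ (Fin 2)) :
    ∫ φ in (-Real.pi)..Real.pi, Real.cos (inner ℝ z (unitVec φ)) =
      2 * Real.pi * besselJ0 ‖z‖ := by
  obtain ⟨α, hα⟩ := exists_eq_norm_smul_unitVec z
  rw [← integral_cos_mul_cos_sub ‖z‖ α]
  congr 1
  ext φ
  rw [← inner_unitVec, ← real_inner_smul_left, ← hα]

/-- Neumann's addition theorem for `J₀`, averaged over the angle. -/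
lemma integral_besselJ0_norm_sub {k : ℝ} (hk : 0 ≤ k) (x : EuclideanSpace ℝ (Fin 2)) (ρ : ℝ) :
    ∫ ψ in (-Real.pi)..Real.pi, besselJ0 (k * ‖x - ρ • unitVec ψ‖) =
      2 * Real.pi * (besselJ0 (k * ‖x‖) * besselJ0 (k * ρ)) := by
  have hnorm (z : EuclideanSpace ℝ (Fin 2)) : k * ‖z‖ = ‖k • z‖ := by
    rw [norm_smul, Real.norm_of_nonneg hk]
  have h2 : (2 * Real.pi) ≠ 0 := by positivity
  have hle : -Real.pi ≤ Real.pi := by linarith [Real.pi_pos]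
  -- The extra `2π` lets `J₀` be replaced by an integral of plane waves over directions `φ`. After
  -- the exchange of integrals the plane waves factor.
  apply mul_left_cancel₀ h2
  rw [← intervalIntegral.integral_const_mul]
  simp_rw [hnorm (x - _), ← integral_cos_inner_unitVec]
  rw [intervalIntegral_intervalIntegral_swap]
  swap
  · have : Continuous fun q : ℝ × ℝ =>
        Real.cos (inner ℝ (k • (x - ρ • unitVec q.1)) (unitVec q.2)) := by fun_prop
    exact (this.continuousOn.integrableOn_compact (isCompact_uIcc.prod isCompact_uIcc)).mono_set
      (prod_mono uIoc_subset_uIcc uIoc_subset_uIcc)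
  -- Expanding the cosine of a difference, the sine part averages to zero over `ψ`.
  have inner_eq (φ : ℝ) : ∫ ψ in (-Real.pi)..Real.pi,
      Real.cos (inner ℝ (k • (x - ρ • unitVec ψ)) (unitVec φ)) =
        Real.cos (inner ℝ (k • x) (unitVec φ)) * (2 * Real.pi * besselJ0 (k * ρ)) := by
    have e (ψ : ℝ) : Real.cos (inner ℝ (k • (x - ρ • unitVec ψ)) (unitVec φ)) =
        Real.cos (inner ℝ (k • x) (unitVec φ)) * Real.cos (k * ρ * Real.cos (ψ - φ)) +
          Real.sin (inner ℝ (k • x) (unitVec φ)) * Real.sin (k * ρ * Real.cos (ψ - φ)) := by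
      rw [smul_sub, inner_sub_left, smul_smul, real_inner_smul_left _ (unitVec φ) (k * ρ),
        inner_unitVec, Real.cos_sub, ← neg_sub ψ φ, Real.cos_neg]
    simp_rw [e]
    rw [intervalIntegral.integral_add
      ((by fun_prop : Continuous fun ψ => Real.cos (inner ℝ (k • x) (unitVec φ)) *
        Real.cos (k * ρ * Real.cos (ψ - φ))).intervalIntegrable _ _)
      ((by fun_prop : Continuous fun ψ => Real.sin (inner ℝ (k • x) (unitVec φ)) *
        Real.sin (k * ρ * Real.cos (ψ - φ))).intervalIntegrable _ _),
      intervalIntegral.integral_const_mul, intervalIntegral.integral_const_mul,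
      integral_cos_mul_cos_sub, integral_sin_mul_cos_sub, mul_zero, add_zero]
  simp_rw [inner_eq]
  rw [intervalIntegral.integral_mul_const, integral_cos_inner_unitVec, ← hnorm]
  ring

end Angular

/-! ### Layer kernels and their angular averages. -/

lemma integral_ball_polar (a : ℝ) (f : EuclideanSpace ℝ (Fin 2) → ℝ) :
    ∫ y in Metric.ball 0 a, f y =
      ∫ q in Ioo 0 a ×ˢ Ioo (-Real.pi) Real.pi, q.1 * f (q.1 • unitVec q.2) := by
  have hs : (Ioi (0 : ℝ) ×ˢ Ioo (-Real.pi) Real.pi) ∩ (Iio a ×ˢ univ) =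
      Ioo 0 a ×ˢ Ioo (-Real.pi) Real.pi := by
    rw [prod_inter_prod, inter_univ, Ioi_inter_Iio]
  rw [← integral_indicator measurableSet_ball, integral_plane_polar, ← hs,
    ← setIntegral_indicator (measurableSet_Iio.prod MeasurableSet.univ)]
  refine setIntegral_congr_fun (measurableSet_Ioi.prod measurableSet_Ioo) fun q hq => ?_
  have hn : ‖q.1 • unitVec q.2‖ = q.1 := by
    rw [norm_smul, norm_unitVec, mul_one, Real.norm_of_nonneg (le_of_lt hq.1)]
  by_cases h : q.1 < a <;> simp [indicator, hn, h]

section BoundedKernel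

variable {X : Type*} [TopologicalSpace X] [FirstCountableTopology X] {w : ℝ → ℝ} {s : Set ℝ}
  {k : X → ℝ → ℝ}

lemma continuous_setIntegral_mul (hw : IntegrableOn w s) (hk : Continuous (Function.uncurry k))
    (hb : ∀ x u, |k x u| ≤ 1) : Continuous fun x => ∫ u in s, w u * k x u := by
  refine continuous_of_dominated (bound := fun u => ‖w u‖) (fun x => ?_) (fun x => ?_) hw.norm ?_
  · exact hw.aestronglyMeasurable.mul (hk.uncurry_left x).aestronglyMeasurable
  · refine Filter.Eventually.of_forall fun u => ?_
    rw [norm_mul]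
    exact mul_le_of_le_one_right (norm_nonneg _) (hb x u)
  · exact Filter.Eventually.of_forall fun u => continuous_const.mul (hk.uncurry_right u)

omit [TopologicalSpace X] [FirstCountableTopology X] in
lemma abs_setIntegral_mul_le (hw : IntegrableOn w s)
    (hb : ∀ x u, |k x u| ≤ 1) (x : X) : |∫ u in s, w u * k x u| ≤ ∫ u in s, |w u| := by
  rw [← Real.norm_eq_abs]
  refine norm_integral_le_of_norm_le hw.norm (Filter.Eventually.of_forall fun u => ?_)
  rw [norm_mul]
  exact mul_le_of_le_one_right (norm_nonneg _) (hb x u)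

end BoundedKernel

section Layer

variable {L : ℝ → ℝ} (hL : IntegrableOn (fun u => 1 - L u) (Ioi (0 : ℝ)))
include hL

lemma continuous_layerF : Continuous (layerF L) :=
  continuous_setIntegral_mul (k := fun t u => besselJ0 (u * t)) hL
    (by unfold Function.uncurry; fun_prop) fun _ _ => abs_besselJ0_le_one _

lemma abs_layerF_le (t : ℝ) : |layerF L t| ≤ ∫ u in Ioi (0 : ℝ), |1 - L u| :=
  abs_setIntegral_mul_le (k := fun t u => besselJ0 (u * t)) hL
    (fun _ _ => abs_besselJ0_le_one _) t

lemma continuous_S0 (τ : ℝ) : Continuous fun σ => S0 L σ τ := by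
  unfold S0
  simp_rw [mul_assoc]
  refine continuous_setIntegral_mul (k := fun σ u => besselJ0 (σ * u) * Real.cos (τ * u)) hL
    (by unfold Function.uncurry; fun_prop) fun σ u => ?_
  rw [abs_mul]
  exact mul_le_one₀ (abs_besselJ0_le_one _) (abs_nonneg _) (Real.abs_cos_le_one _)

lemma abs_S0_le (σ τ : ℝ) : |S0 L σ τ| ≤ ∫ u in Ioi (0 : ℝ), |1 - L u| := by
  unfold S0
  simp_rw [mul_assoc]
  refine abs_setIntegral_mul_le (k := fun σ u => besselJ0 (σ * u) * Real.cos (τ * u)) hL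
    (fun σ u => ?_) σ
  rw [abs_mul]
  exact mul_le_one₀ (abs_besselJ0_le_one _) (abs_nonneg _) (Real.abs_cos_le_one _)

/-- Fubini reduces this to the addition theorem at each frequency `u / h`. -/
lemma integral_layerF_norm_sub {h : ℝ} (hh : 0 < h) (x : EuclideanSpace ℝ (Fin 2)) (ρ : ℝ) :
    ∫ ψ in Ioo (-Real.pi) Real.pi, layerF L (‖x - ρ • unitVec ψ‖ / h) =
      2 * Real.pi * layerF2 L (ρ / h) (‖x‖ / h) := by
  unfold layerF layerF2
  rw [integral_integral_swap, ← integral_const_mul]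
  · refine setIntegral_congr_fun measurableSet_Ioi fun u hu => ?_
    have hk : 0 ≤ u / h := div_nonneg (le_of_lt hu) hh.le
    have h1 := integral_besselJ0_norm_sub hk x ρ
    rw [intervalIntegral.integral_of_le (by linarith [Real.pi_pos]),
      integral_Ioc_eq_integral_Ioo] at h1
    have e (ψ : ℝ) : u * (‖x - ρ • unitVec ψ‖ / h) = u / h * ‖x - ρ • unitVec ψ‖ := by ring
    simp only [integral_const_mul, e]
    rw [h1, show u / h * ‖x‖ = ‖x‖ / h * u by ring, show u / h * ρ = ρ / h * u by ring]
    ring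
  · have h1 : Integrable (fun z : ℝ × ℝ => (1 : ℝ) * (1 - L z.2))
        ((volume.restrict (Ioo (-Real.pi) Real.pi)).prod (volume.restrict (Ioi 0))) :=
      (integrable_const (1 : ℝ)).mul_prod hL
    simp only [one_mul] at h1
    refine h1.mul_bdd (c := 1) ?_ (Filter.Eventually.of_forall fun z => abs_besselJ0_le_one _)
    exact (by fun_prop : Continuous fun z : ℝ × ℝ =>
      besselJ0 (z.2 * (‖x - ρ • unitVec z.1‖ / h))).aestronglyMeasurable

lemma integral_ball_layerF {h a : ℝ} (hh : 0 < h) (ha : 0 < a) {p : ℝ → ℝ}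
    (hp : IntegrableOn (fun ρ => p ρ * ρ) (Ioo 0 a)) (x : EuclideanSpace ℝ (Fin 2)) :
    ∫ y in Metric.ball 0 a, layerF L (‖x - y‖ / h) * p ‖y‖ =
      2 * Real.pi * ∫ ρ in (0 : ℝ)..a, layerF2 L (ρ / h) (‖x‖ / h) * p ρ * ρ := by
  have hc := continuous_layerF hL
  have e : ∀ q ∈ Ioo 0 a ×ˢ Ioo (-Real.pi) Real.pi,
      q.1 * (layerF L (‖x - q.1 • unitVec q.2‖ / h) * p ‖q.1 • unitVec q.2‖) =
        p q.1 * q.1 * layerF L (‖x - q.1 • unitVec q.2‖ / h) := fun q hq => by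
    rw [norm_smul, norm_unitVec, mul_one, Real.norm_of_nonneg (le_of_lt hq.1.1)]
    ring
  rw [integral_ball_polar, setIntegral_congr_fun (measurableSet_Ioo.prod measurableSet_Ioo) e,
    Measure.volume_eq_prod, setIntegral_prod, intervalIntegral.integral_of_le ha.le,
    integral_Ioc_eq_integral_Ioo, ← integral_const_mul]
  · refine setIntegral_congr_fun measurableSet_Ioo fun ρ _ => ?_
    simp only
    rw [integral_const_mul, integral_layerF_norm_sub hL hh]
    ring
  · rw [IntegrableOn, ← Measure.prod_restrict]
    have h1 : Integrable (fun z : ℝ × ℝ => (p z.1 * z.1) * 1)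
        ((volume.restrict (Ioo 0 a)).prod (volume.restrict (Ioo (-Real.pi) Real.pi))) :=
      Integrable.mul_prod (f := fun ρ => p ρ * ρ) (g := fun _ => 1) hp (integrable_const (1 : ℝ))
    simp only [mul_one] at h1
    refine h1.mul_bdd (c := ∫ u in Ioi (0 : ℝ), |1 - L u|) ?_
      (Filter.Eventually.of_forall fun z => abs_layerF_le hL _)
    exact (by fun_prop : Continuous fun z : ℝ × ℝ =>
      layerF L (‖x - z.1 • unitVec z.2‖ / h)).aestronglyMeasurable

end Layer

/-! ### Superpositions of Bessel functions. -/

section BesselTransform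

variable {X : Type*} [MeasurableSpace X] {μ : Measure X} [SFinite μ] {W k : X → ℝ}
  (hW : Integrable W μ) (hk : Measurable k) (hkW : Integrable (fun q => W q * k q) μ)
include hW hk hkW

omit [SFinite μ] in
-- Differentiation under the integral sign, dominated by `|W k|` since `|J₀'| ≤ 1`. The same bound
-- gives the Lipschitz constant.
lemma hasDerivAt_integral_mul_besselJ0 (r : ℝ) :
    HasDerivAt (fun r => ∫ q, W q * besselJ0 (k q * r) ∂μ)
      (∫ q, W q * k q * besselJ0Deriv (k q * r) ∂μ) r := by
  refine (hasDerivAt_integral_of_dominated_loc_of_deriv_le (μ := μ) (s := univ)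
    (F' := fun r q => W q * k q * besselJ0Deriv (k q * r))
    (bound := fun q => ‖W q * k q‖) Filter.univ_mem ?_ ?_ ?_ ?_ hkW.norm ?_).2
  · refine Filter.Eventually.of_forall fun y => hW.aestronglyMeasurable.mul ?_
    exact (continuous_besselJ0.measurable.comp (hk.mul_const y)).aestronglyMeasurable
  · exact hW.mul_bdd (c := 1)
      (continuous_besselJ0.measurable.comp (hk.mul_const r)).aestronglyMeasurable
      (Filter.Eventually.of_forall fun q => abs_besselJ0_le_one _)
  · exact hkW.aestronglyMeasurable.mul
      (continuous_besselJ0Deriv.measurable.comp (hk.mul_const r)).aestronglyMeasurable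
  · refine Filter.Eventually.of_forall fun q y _ => ?_
    rw [norm_mul]
    exact mul_le_of_le_one_right (norm_nonneg _) (abs_besselJ0Deriv_le_one _)
  · refine Filter.Eventually.of_forall fun q y _ => ?_
    refine (((hasDerivAt_besselJ0 (k q * y)).comp y
      ((hasDerivAt_id y).const_mul (k q))).const_mul (W q)).congr_deriv ?_
    ring

omit [SFinite μ] hW hk in
lemma norm_integral_mul_besselJ0Deriv_le (r : ℝ) :
    ‖∫ q, W q * k q * besselJ0Deriv (k q * r) ∂μ‖ ≤ ∫ q, ‖W q * k q‖ ∂μ := by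
  refine norm_integral_le_of_norm_le hkW.norm (Filter.Eventually.of_forall fun q => ?_)
  rw [norm_mul]
  exact mul_le_of_le_one_right (norm_nonneg _) (abs_besselJ0Deriv_le_one _)

omit [SFinite μ] in
lemma exists_lipschitzWith_integral_mul_besselJ0 :
    ∃ C, LipschitzWith C (fun r => ∫ q, W q * besselJ0 (k q * r) ∂μ) :=
  ⟨(∫ q, ‖W q * k q‖ ∂μ).toNNReal, lipschitzWith_of_nnnorm_deriv_le
    (fun r => (hasDerivAt_integral_mul_besselJ0 hW hk hkW r).differentiableAt) fun r => by
      rw [(hasDerivAt_integral_mul_besselJ0 hW hk hkW r).deriv, ← NNReal.coe_le_coe, coe_nnnorm,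
        Real.coe_toNNReal _ (integral_nonneg fun _ => norm_nonneg _)]
      exact norm_integral_mul_besselJ0Deriv_le hkW r⟩

/-- The Abel transform turns a superposition of functions `J₀(k r)` into one of `cos (k a)`. -/
lemma abel_integral_mul_besselJ0 {a : ℝ} (ha : 0 < a) :
    ∫ q, W q ∂μ + a * ∫ t in (0 : ℝ)..(Real.pi / 2),
      ∫ q, W q * k q * besselJ0Deriv (k q * (a * Real.sin t)) ∂μ =
        ∫ q, W q * Real.cos (k q * a) ∂μ := by
  have hprod : Integrable (fun z : ℝ × X => W z.2 * k z.2 *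
      besselJ0Deriv (k z.2 * (a * Real.sin z.1)))
      ((volume.restrict (Ioc 0 (Real.pi / 2))).prod μ) := by
    have h1 : Integrable (fun z : ℝ × X => 1 * (W z.2 * k z.2))
        ((volume.restrict (Ioc 0 (Real.pi / 2))).prod μ) :=
      (integrable_const (1 : ℝ)).mul_prod hkW
    simp only [one_mul] at h1
    refine h1.mul_bdd (c := 1) ?_
      (Filter.Eventually.of_forall fun z => abs_besselJ0Deriv_le_one _)
    exact (continuous_besselJ0Deriv.measurable.comp (by fun_prop)).aestronglyMeasurable
  rw [intervalIntegral.integral_of_le (by positivity), integral_integral_swap hprod,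
    ← integral_const_mul, ← integral_add hW (hprod.integral_prod_right.const_mul a)]
  refine integral_congr_ae (Filter.Eventually.of_forall fun q => ?_)
  have h := one_add_integral_besselJ0Deriv ha (k q)
  simp only
  rw [← h, intervalIntegral.integral_of_le (by positivity)]
  simp_rw [mul_assoc (W q)]
  rw [integral_const_mul]
  ring

end BesselTransform

/-! ### The layer contribution and its Abel transform. -/

section LayerTerm

/-- The contribution of the layer to the surface displacement at radius `r`, before scaling. -/
noncomputable def layerTerm (L : ℝ → ℝ) (h a : ℝ) (p : ℝ → ℝ) (r : ℝ) : ℝ :=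
  ∫ ρ in (0 : ℝ)..a, layerF2 L (ρ / h) (r / h) * p ρ * ρ

variable {L : ℝ → ℝ} {h a : ℝ} {p : ℝ → ℝ}

/-- The weight representing `layerTerm` as a superposition of Bessel functions. -/
noncomputable def layerWeight (L : ℝ → ℝ) (h : ℝ) (p : ℝ → ℝ) (q : ℝ × ℝ) : ℝ :=
  p q.1 * q.1 * (1 - L q.2) * besselJ0 (q.1 / h * q.2)

/-- The measure on which `layerWeight` is integrated. -/
noncomputable abbrev layerMeasure (a : ℝ) : Measure (ℝ × ℝ) :=
  (volume.restrict (Ioo 0 a)).prod (volume.restrict (Ioi 0))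

lemma integrable_layerWeight (hL0 : IntegrableOn (fun u => 1 - L u) (Ioi (0 : ℝ)))
    (hp : IntegrableOn (fun ρ => p ρ * ρ) (Ioo 0 a)) :
    Integrable (layerWeight L h p) (layerMeasure a) := by
  have h1 : Integrable (fun z : ℝ × ℝ => (p z.1 * z.1) * (1 - L z.2)) (layerMeasure a) :=
    Integrable.mul_prod (f := fun ρ => p ρ * ρ) (g := fun u => 1 - L u) hp hL0
  exact h1.mul_bdd (c := 1) (by fun_prop : Continuous fun z : ℝ × ℝ =>
    besselJ0 (z.1 / h * z.2)).aestronglyMeasurable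
    (Filter.Eventually.of_forall fun z => abs_besselJ0_le_one _)

/-- The frequency being `u / h`, this is where the first moment of `1 - L` is needed. -/
lemma integrable_layerWeight_mul (hL1 : IntegrableOn (fun u => (1 - L u) * u) (Ioi (0 : ℝ)))
    (hp : IntegrableOn (fun ρ => p ρ * ρ) (Ioo 0 a)) :
    Integrable (fun q => layerWeight L h p q * (q.2 / h)) (layerMeasure a) := by
  have h1 : Integrable (fun z : ℝ × ℝ => (p z.1 * z.1) * ((1 - L z.2) * z.2)) (layerMeasure a) :=
    Integrable.mul_prod (f := fun ρ => p ρ * ρ) (g := fun u => (1 - L u) * u) hp hL1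
  have h2 : Integrable (fun z : ℝ × ℝ => (p z.1 * z.1) * ((1 - L z.2) * z.2) *
      besselJ0 (z.1 / h * z.2)) (layerMeasure a) :=
    h1.mul_bdd (c := 1) (by fun_prop : Continuous fun z : ℝ × ℝ =>
      besselJ0 (z.1 / h * z.2)).aestronglyMeasurable
      (Filter.Eventually.of_forall fun z => abs_besselJ0_le_one _)
  refine (h2.mul_const h⁻¹).congr (Filter.Eventually.of_forall fun z => ?_)
  simp only [layerWeight]
  ring

/-- Taking `f` to be a Bessel function yields `layerTerm`; taking it to be a cosine yields the
integral of `S0`. -/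
lemma integral_layerWeight_mul (ha : 0 < a)
    (hL0 : IntegrableOn (fun u => 1 - L u) (Ioi (0 : ℝ)))
    (hp : IntegrableOn (fun ρ => p ρ * ρ) (Ioo 0 a)) {f : ℝ → ℝ} (hf : Continuous f)
    (hb : ∀ x, |f x| ≤ 1) :
    ∫ q, layerWeight L h p q * f q.2 ∂(layerMeasure a) =
      ∫ ρ in (0 : ℝ)..a, (∫ u in Ioi (0 : ℝ), (1 - L u) * besselJ0 (ρ / h * u) * f u) *
        p ρ * ρ := by
  rw [integral_prod, intervalIntegral.integral_of_le ha.le, integral_Ioc_eq_integral_Ioo]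
  · refine setIntegral_congr_fun measurableSet_Ioo fun ρ _ => ?_
    simp only [layerWeight]
    rw [mul_assoc, ← integral_mul_const]
    congr 1
    ext u
    ring
  · exact (integrable_layerWeight hL0 hp).mul_bdd (c := 1)
      (hf.comp continuous_snd).aestronglyMeasurable (Filter.Eventually.of_forall fun q => hb _)

lemma layerTerm_eq (ha : 0 < a) (hL0 : IntegrableOn (fun u => 1 - L u) (Ioi (0 : ℝ)))
    (hp : IntegrableOn (fun ρ => p ρ * ρ) (Ioo 0 a)) :
    layerTerm L h a p = fun r => ∫ q, layerWeight L h p q * besselJ0 (q.2 / h * r)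
      ∂(layerMeasure a) := by
  funext r
  rw [integral_layerWeight_mul ha hL0 hp (f := fun u => besselJ0 (u / h * r)) (by fun_prop)
    fun _ => abs_besselJ0_le_one _, layerTerm]
  simp only [layerF2, show ∀ u, r / h * u = u / h * r from fun u => by ring]

variable (ha : 0 < a) (hL0 : IntegrableOn (fun u => 1 - L u) (Ioi (0 : ℝ)))
    (hL1 : IntegrableOn (fun u => (1 - L u) * u) (Ioi (0 : ℝ)))
    (hp : IntegrableOn (fun ρ => p ρ * ρ) (Ioo 0 a))
include ha hL0 hL1 hp

lemma differentiable_layerTerm : Differentiable ℝ (layerTerm L h a p) := by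
  rw [layerTerm_eq ha hL0 hp]
  exact fun r => (hasDerivAt_integral_mul_besselJ0 (integrable_layerWeight hL0 hp)
    (by fun_prop) (integrable_layerWeight_mul hL1 hp) r).differentiableAt

lemma exists_lipschitzWith_layerTerm : ∃ C, LipschitzWith C (layerTerm L h a p) := by
  rw [layerTerm_eq ha hL0 hp]
  exact exists_lipschitzWith_integral_mul_besselJ0 (integrable_layerWeight hL0 hp)
    (by fun_prop) (integrable_layerWeight_mul hL1 hp)

lemma abel_layerTerm : layerTerm L h a p 0 +
    a * ∫ t in (0 : ℝ)..(Real.pi / 2), deriv (layerTerm L h a p) (a * Real.sin t) =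
      ∫ ρ in (0 : ℝ)..a, S0 L (ρ / h) (a / h) * p ρ * ρ := by
  have hW := integrable_layerWeight (h := h) hL0 hp
  have hkW := integrable_layerWeight_mul (h := h) hL1 hp
  have hk : Measurable fun q : ℝ × ℝ => q.2 / h := by fun_prop
  have h1 := abel_integral_mul_besselJ0 hW hk hkW ha
  have h2 := integral_layerWeight_mul (h := h) ha hL0 hp (f := fun u => Real.cos (u / h * a))
    (by fun_prop) fun _ => Real.abs_cos_le_one _
  rw [h2] at h1
  rw [layerTerm_eq ha hL0 hp]
  simp only [(hasDerivAt_integral_mul_besselJ0 hW hk hkW _).deriv, mul_zero, besselJ0_zero,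
    mul_one]
  rw [h1]
  simp only [S0, show ∀ u, a / h * u = u / h * a from fun u => by ring]

end LayerTerm

/-! ### Regularity of the indenter profile. -/

/-- The profile of a radial convex function is Lipschitz on every shorter interval. -/
lemma exists_lipschitzOnWith_profile {Φ : ℝ → ℝ} {a b : ℝ} (hab : a < b)
    (hΦ : ConvexOn ℝ (Metric.ball (0 : EuclideanSpace ℝ (Fin 2)) b) (fun x => Φ ‖x‖)) :
    ∃ c > a, ∃ K, LipschitzOnWith K Φ (Ico 0 c) := by
  -- Two radii `a < c < d < b`: the function is bounded on the ball of radius `d`, and a bounded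
  -- convex function is Lipschitz on the smaller ball of radius `c`.
  obtain ⟨d, had, hdb⟩ := exists_between hab
  obtain ⟨c, hac, hcd⟩ := exists_between had
  have hcont : ContinuousOn (fun x => Φ ‖x‖)
      (Metric.ball (0 : EuclideanSpace ℝ (Fin 2)) b) :=
    (hΦ.locallyLipschitzOn Metric.isOpen_ball).continuousOn
  have hbdd : Bornology.IsBounded ((fun x => Φ ‖x‖) ''
      Metric.ball (0 : EuclideanSpace ℝ (Fin 2)) d) :=
    (((isCompact_closedBall 0 d).image_of_continuousOn
      (hcont.mono (Metric.closedBall_subset_ball hdb))).isBounded).subset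
      (image_mono Metric.ball_subset_closedBall)
  obtain ⟨K, hK⟩ := (hΦ.subset (Metric.ball_subset_ball hdb.le)
    (convex_ball 0 d)).exists_lipschitzOnWith_of_isBounded hcd hbdd
  refine ⟨c, hac, K, LipschitzOnWith.of_dist_le_mul fun s hs t ht => ?_⟩
  have hn {s : ℝ} (hs : s ∈ Ico 0 c) : ‖s • unitVec 0‖ = s := by
    rw [norm_smul, norm_unitVec, mul_one, Real.norm_of_nonneg hs.1]
  have hm {s : ℝ} (hs : s ∈ Ico 0 c) : s • unitVec 0 ∈ Metric.ball 0 c := by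
    rw [mem_ball_zero_iff, hn hs]
    exact hs.2
  have h := hK.dist_le_mul _ (hm hs) _ (hm ht)
  rw [hn hs, hn ht, dist_eq_norm (s • _), ← sub_smul, norm_smul, norm_unitVec, mul_one] at h
  exact h

/-! ### The edge condition. -/

section Abel

variable {p V : ℝ → ℝ} {a : ℝ}

/-- The Abel transform of the potential of a radial density is the integral of the density
against the potential of the disc. -/
lemma two_pi_mul_abel_eq
    (hint : IntegrableOn (fun y : EuclideanSpace ℝ (Fin 2) => p ‖y‖) (Metric.ball 0 a))
    (hpos : ∀ r, 0 ≤ r → r < a → 0 < p r) (hV : Continuous V)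
    (hVint : ∀ x ∈ Metric.ball (0 : EuclideanSpace ℝ (Fin 2)) a,
      IntegrableOn (fun y => p ‖y‖ / ‖x - y‖) (Metric.ball 0 a))
    (hVeq : ∀ x ∈ Metric.ball (0 : EuclideanSpace ℝ (Fin 2)) a,
      V ‖x‖ = ∫ y in Metric.ball 0 a, p ‖y‖ / ‖x - y‖)
    {r : ℝ} (hr : 0 < r) (hra : r ≤ a) :
    2 * Real.pi * ∫ t in (0 : ℝ)..(Real.pi / 2), r * V (r * Real.sin t) * Real.sin t =
      (∫⁻ y in Metric.ball 0 a, ENNReal.ofReal (p ‖y‖) * discPotential r y).toReal := by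
  have hpn : ∀ y ∈ Metric.ball (0 : EuclideanSpace ℝ (Fin 2)) a, 0 ≤ p ‖y‖ := fun y hy =>
    (hpos _ (norm_nonneg y) (mem_ball_zero_iff.1 hy)).le
  have hsub : Metric.ball (0 : EuclideanSpace ℝ (Fin 2)) r ⊆ Metric.ball 0 a :=
    Metric.ball_subset_ball hra
  have hVn : ∀ x ∈ Metric.ball (0 : EuclideanSpace ℝ (Fin 2)) a, 0 ≤ V ‖x‖ := fun x hx => by
    rw [hVeq x hx]
    exact setIntegral_nonneg measurableSet_ball fun y hy => div_nonneg (hpn y hy) (norm_nonneg _)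
  have h1 : 2 * Real.pi * ∫ t in (0 : ℝ)..(Real.pi / 2), r * V (r * Real.sin t) * Real.sin t =
      ∫ x in Metric.ball (0 : EuclideanSpace ℝ (Fin 2)) r, V ‖x‖ / √(r ^ 2 - ‖x‖ ^ 2) := by
    have e : ∀ q ∈ Ioo 0 r ×ˢ Ioo (-Real.pi) Real.pi, q.1 * (V ‖q.1 • unitVec q.2‖ /
        √(r ^ 2 - ‖q.1 • unitVec q.2‖ ^ 2)) =
          (q.1 * V q.1 / √(r ^ 2 - q.1 ^ 2)) * 1 := fun q hq => by
      rw [norm_smul, norm_unitVec, mul_one, Real.norm_of_nonneg (le_of_lt hq.1.1)]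
      ring
    rw [integral_ball_polar, setIntegral_congr_fun (measurableSet_Ioo.prod measurableSet_Ioo) e,
      Measure.volume_eq_prod, setIntegral_prod_mul (fun s => s * V s / √(r ^ 2 - s ^ 2))
        (fun _ => (1 : ℝ)),
      ← integral_Ioc_eq_integral_Ioo, ← intervalIntegral.integral_of_le hr.le,
      integral_div_sqrt_sq_sub_sq hr (fun s => s * V s)]
    simp only [integral_const, smul_eq_mul, mul_one, MeasurableSet.univ, measureReal_restrict_apply,
      univ_inter, Real.volume_real_Ioo_of_le (neg_le_self Real.pi_pos.le)]
    rw [mul_comm, show Real.pi - -Real.pi = 2 * Real.pi by ring]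
    congr 2
    ext t
    ring
  -- Since `p` and `V` are nonnegative here, the integrals can be exchanged by Tonelli, with no
  -- joint integrability to check.
  rw [h1, integral_eq_lintegral_of_nonneg_ae]
  · congr 1
    have h2 : ∀ x ∈ Metric.ball (0 : EuclideanSpace ℝ (Fin 2)) r,
        ENNReal.ofReal (V ‖x‖ / √(r ^ 2 - ‖x‖ ^ 2)) =
          ∫⁻ y in Metric.ball 0 a, ENNReal.ofReal (p ‖y‖) *
            ENNReal.ofReal (1 / (‖x - y‖ * √(r ^ 2 - ‖x‖ ^ 2))) := fun x hx => by
      rw [div_eq_mul_inv, ENNReal.ofReal_mul (hVn x (hsub hx)), hVeq x (hsub hx),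
        ofReal_integral_eq_lintegral_ofReal (hVint x (hsub hx))
          ((ae_restrict_mem measurableSet_ball).mono fun y hy =>
            div_nonneg (hpn y hy) (norm_nonneg _)),
        ← lintegral_mul_const' _ _ ENNReal.ofReal_ne_top]
      refine setLIntegral_congr_fun measurableSet_ball fun y hy => ?_
      rw [← ENNReal.ofReal_mul (div_nonneg (hpn y hy) (norm_nonneg _)),
        ← ENNReal.ofReal_mul (hpn y hy)]
      congr 1
      rw [one_div, mul_inv, div_eq_mul_inv, mul_assoc]
    rw [setLIntegral_congr_fun measurableSet_ball h2, lintegral_lintegral_swap]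
    · refine lintegral_congr fun y => ?_
      rw [lintegral_const_mul' _ _ ENNReal.ofReal_ne_top, discPotential,
        setLIntegral_eq_of_support_subset]
      intro x hx
      by_contra hxr
      apply hx
      rw [mem_ball_zero_iff, not_lt] at hxr
      simp only
      rw [Real.sqrt_eq_zero_of_nonpos (by nlinarith)]
      simp
    · refine AEMeasurable.mul (f := fun z : EuclideanSpace ℝ (Fin 2) × EuclideanSpace ℝ (Fin 2) =>
        ENNReal.ofReal (p ‖z.2‖)) (g := fun z =>
          ENNReal.ofReal (1 / (‖z.1 - z.2‖ * √(r ^ 2 - ‖z.1‖ ^ 2)))) ?_ ?_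
      · exact (hint.aestronglyMeasurable.aemeasurable.ennreal_ofReal).comp_snd
      · refine Measurable.aemeasurable (ENNReal.measurable_ofReal.comp (measurable_const.div ?_))
        exact (by fun_prop : Continuous fun z :
          EuclideanSpace ℝ (Fin 2) × EuclideanSpace ℝ (Fin 2) =>
            ‖z.1 - z.2‖ * √(r ^ 2 - ‖z.1‖ ^ 2)).measurable
  · exact (ae_restrict_mem measurableSet_ball).mono fun x hx =>
      div_nonneg (hVn x (hsub hx)) (Real.sqrt_nonneg _)
  · refine (Measurable.div ?_ ?_).aestronglyMeasurable
    · exact (by fun_prop : Continuous fun x : EuclideanSpace ℝ (Fin 2) => V ‖x‖).measurable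
    · exact (by fun_prop : Continuous fun x : EuclideanSpace ℝ (Fin 2) =>
        √(r ^ 2 - ‖x‖ ^ 2)).measurable

/-- The mass of a density bounded by `ε` on the annulus `r ≤ |y| < a`. -/
lemma lintegral_annulus_le {ε r : ℝ} (hε : 0 ≤ ε) (hr : 0 < r) (hra : r ≤ a)
    (hb : ∀ ρ, r ≤ ρ → ρ < a → p ρ ≤ ε) :
    ∫⁻ y in Metric.ball (0 : EuclideanSpace ℝ (Fin 2)) a \ Metric.ball 0 r,
      ENNReal.ofReal (p ‖y‖) ≤ ENNReal.ofReal (ε * (Real.pi * (a ^ 2 - r ^ 2))) := by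
  have ha : 0 < a := hr.trans_le hra
  calc _ ≤ ∫⁻ _ in Metric.ball (0 : EuclideanSpace ℝ (Fin 2)) a \ Metric.ball 0 r,
        ENNReal.ofReal ε := by
        refine setLIntegral_mono' (measurableSet_ball.diff measurableSet_ball) fun y hy => ?_
        refine ENNReal.ofReal_le_ofReal (hb _ ?_ ?_)
        · simpa using hy.2
        · simpa using hy.1
    _ = _ := by
      rw [setLIntegral_const, measure_sdiff (Metric.ball_subset_ball hra)
        measurableSet_ball.nullMeasurableSet measure_ball_lt_top.ne,
        EuclideanSpace.volume_ball_fin_two, EuclideanSpace.volume_ball_fin_two,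
        ← ENNReal.ofReal_pow ha.le, ← ENNReal.ofReal_pow hr.le,
        ← ENNReal.ofReal_mul (by positivity), ← ENNReal.ofReal_mul (by positivity),
        ← ENNReal.ofReal_sub _ (by positivity), ← ENNReal.ofReal_mul hε]
      ring_nf

/-- The potentials for `r` and `a` both equal `π²` on the disc of radius `r`, and on the remaining
annulus they differ by at most `π²`. Only the mass of the annulus enters. -/
lemma abel_sub_bounds (ha : 0 < a)
    (hint : IntegrableOn (fun y : EuclideanSpace ℝ (Fin 2) => p ‖y‖) (Metric.ball 0 a))
    {ε r : ℝ} (hε : 0 ≤ ε) (hr : 0 < r) (hra : r ≤ a) (hb : ∀ ρ, r ≤ ρ → ρ < a → p ρ ≤ ε) :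
    (∫⁻ y in Metric.ball 0 a, ENNReal.ofReal (p ‖y‖) * discPotential r y).toReal ≤
      (∫⁻ y in Metric.ball 0 a, ENNReal.ofReal (p ‖y‖) * discPotential a y).toReal ∧
    (∫⁻ y in Metric.ball 0 a, ENNReal.ofReal (p ‖y‖) * discPotential a y).toReal ≤
      (∫⁻ y in Metric.ball 0 a, ENNReal.ofReal (p ‖y‖) * discPotential r y).toReal +
        ε * (Real.pi * (a ^ 2 - r ^ 2)) * Real.pi ^ 2 := by
  have hsub : Metric.ball (0 : EuclideanSpace ℝ (Fin 2)) r ⊆ Metric.ball 0 a :=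
    Metric.ball_subset_ball hra
  have hIa : ∫⁻ y in Metric.ball 0 a, ENNReal.ofReal (p ‖y‖) * discPotential a y =
      (∫⁻ y in Metric.ball (0 : EuclideanSpace ℝ (Fin 2)) a, ENNReal.ofReal (p ‖y‖)) *
        ENNReal.ofReal (Real.pi ^ 2) := by
    rw [← lintegral_mul_const' _ _ ENNReal.ofReal_ne_top]
    refine setLIntegral_congr_fun measurableSet_ball fun y hy => ?_
    rw [discPotential_eq (mem_ball_zero_iff.1 hy)]
  have hfin : ∫⁻ y in Metric.ball 0 a, ENNReal.ofReal (p ‖y‖) * discPotential a y ≠ ⊤ := by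
    rw [hIa]
    refine ENNReal.mul_ne_top ?_ ENNReal.ofReal_ne_top
    have := hint.lintegral_lt_top
    exact this.ne
  have hle : ∫⁻ y in Metric.ball 0 a, ENNReal.ofReal (p ‖y‖) * discPotential r y ≤
      ∫⁻ y in Metric.ball 0 a, ENNReal.ofReal (p ‖y‖) * discPotential a y := by
    rw [hIa, ← lintegral_mul_const' _ _ ENNReal.ofReal_ne_top]
    exact lintegral_mono fun y => mul_le_mul_right (discPotential_le r y) _
  have hge : ∫⁻ y in Metric.ball 0 a, ENNReal.ofReal (p ‖y‖) * discPotential a y ≤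
      (∫⁻ y in Metric.ball 0 a, ENNReal.ofReal (p ‖y‖) * discPotential r y) +
        ENNReal.ofReal (ε * (Real.pi * (a ^ 2 - r ^ 2)) * Real.pi ^ 2) := by
    have hnn : 0 ≤ ε * (Real.pi * (a ^ 2 - r ^ 2)) :=
      mul_nonneg hε (mul_nonneg Real.pi_pos.le (by nlinarith))
    rw [hIa, ENNReal.ofReal_mul hnn, ← lintegral_inter_add_sdiff _ _ (measurableSet_ball (ε := r)),
      add_mul, inter_eq_right.2 hsub]
    refine add_le_add ?_ (mul_le_mul_left (lintegral_annulus_le hε hr hra hb) _)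
    rw [← lintegral_mul_const' _ _ ENNReal.ofReal_ne_top]
    refine le_trans (le_of_eq ?_) (lintegral_mono_set hsub)
    refine setLIntegral_congr_fun measurableSet_ball fun y hy => ?_
    rw [discPotential_eq (mem_ball_zero_iff.1 hy)]
  have hnn : 0 ≤ ε * (Real.pi * (a ^ 2 - r ^ 2)) * Real.pi ^ 2 :=
    mul_nonneg (mul_nonneg hε (mul_nonneg Real.pi_pos.le (by nlinarith))) (by positivity)
  have hfin' := ne_top_of_le_ne_top hfin hle
  refine ⟨ENNReal.toReal_mono hfin hle, ?_⟩
  have := ENNReal.toReal_mono (ENNReal.add_ne_top.2 ⟨hfin', ENNReal.ofReal_ne_top⟩) hge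
  rwa [ENNReal.toReal_add hfin' ENNReal.ofReal_ne_top, ENNReal.toReal_ofReal hnn] at this

/-- If the density vanishes continuously at the edge of the disc, the derivative of the Abel
transform of its potential vanishes at the edge. -/
lemma abel_deriv_eq_zero {K : NNReal} (hV : LipschitzWith K V) (ha : 0 < a)
    (hint : IntegrableOn (fun y : EuclideanSpace ℝ (Fin 2) => p ‖y‖) (Metric.ball 0 a))
    (hpos : ∀ r, 0 ≤ r → r < a → 0 < p r)
    (hpa : p a = 0) (hpc : ContinuousWithinAt p (Iic a) a)
    (hVint : ∀ x ∈ Metric.ball (0 : EuclideanSpace ℝ (Fin 2)) a,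
      IntegrableOn (fun y => p ‖y‖ / ‖x - y‖) (Metric.ball 0 a))
    (hVeq : ∀ x ∈ Metric.ball (0 : EuclideanSpace ℝ (Fin 2)) a,
      V ‖x‖ = ∫ y in Metric.ball 0 a, p ‖y‖ / ‖x - y‖) :
    V 0 + a * ∫ t in (0 : ℝ)..(Real.pi / 2), deriv V (a * Real.sin t) = 0 := by
  have hd := hasDerivAt_abel hV ha
  set D := V 0 + a * ∫ t in (0 : ℝ)..(Real.pi / 2), deriv V (a * Real.sin t)
  set A : ℝ → ℝ := fun r => ∫ t in (0 : ℝ)..(Real.pi / 2), r * V (r * Real.sin t) * Real.sin t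
  have hA {r : ℝ} (hr : 0 < r) (hra : r ≤ a) : 2 * Real.pi * A r = _ :=
    two_pi_mul_abel_eq hint hpos hV.continuous hVint hVeq hr hra
  -- Left slopes suffice: `A` is expressed through the pressure only for `r ≤ a`, while the
  -- derivative at `a` is already known to exist.
  have hslope := (hasDerivWithinAt_iff_tendsto_slope' (s := Iio a) (by simp)).1
    hd.hasDerivWithinAt
  have hpi := Real.pi_pos
  have key (ε : ℝ) (hε : 0 < ε) :
      ∀ᶠ r in nhdsWithin a (Iio a), 0 ≤ slope A a r ∧ slope A a r ≤ ε * (Real.pi ^ 2 * a) := by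
    have h1 : ∀ᶠ r in nhdsWithin a (Iic a), p r < ε :=
      hpc.eventually (gt_mem_nhds (by rw [hpa]; exact hε))
    obtain ⟨l, hl, hlε⟩ := (mem_nhdsLE_iff_exists_Ioc_subset).1 h1
    filter_upwards [Ioo_mem_nhdsLT (max_lt (mem_Iio.1 hl) ha)] with r hr
    have hr0 : 0 < r := (le_max_right _ _).trans_lt hr.1
    have hlr : l < r := (le_max_left _ _).trans_lt hr.1
    obtain ⟨b1, b2⟩ := abel_sub_bounds ha hint hε.le hr0 hr.2.le fun ρ h1 h2 =>
      (hlε ⟨hlr.trans_le h1, h2.le⟩).le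
    rw [← hA hr0 hr.2.le, ← hA ha le_rfl] at b1 b2
    have hpos' : 0 < a - r := sub_pos.2 hr.2
    have e : slope A a r = (A a - A r) / (a - r) := by
      rw [slope_def_field, ← neg_sub (A a), ← neg_sub a, neg_div_neg_eq]
    rw [e]
    constructor
    · refine div_nonneg ?_ hpos'.le
      nlinarith
    · rw [div_le_iff₀ hpos']
      -- From `a² - r² = (a + r)(a - r)`; then `(a + r) / 2 ≤ a` gives the uniform slope bound `ε π²
      -- a`.
      have b3 : 2 * Real.pi * (A a - A r) ≤
          2 * Real.pi * (ε * (Real.pi ^ 2 * ((a + r) / 2)) * (a - r)) := by linarith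
      have b4 := le_of_mul_le_mul_left b3 (by positivity)
      refine b4.trans ?_
      gcongr
      linarith [hr.2]
  refine le_antisymm ?_ ?_
  · refine le_of_forall_pos_le_add fun δ hδ => ?_
    have hc : 0 < Real.pi ^ 2 * a := by positivity
    refine (le_of_tendsto hslope ((key (δ / (Real.pi ^ 2 * a)) (by positivity)).mono
      fun r hr => hr.2)).trans ?_
    rw [div_mul_cancel₀ _ hc.ne', zero_add]
  · exact ge_of_tendsto hslope ((key 1 one_pos).mono fun r hr => hr.1)

end Abel

/-! ### The contact equation as a half-space potential equation. -/

lemma IsContactPressure.integrableOn_mul_self {L : ℝ → ℝ} {θ h w a : ℝ} {Φ p : ℝ → ℝ}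
    (hp : IsContactPressure L θ h Φ w a p) : IntegrableOn (fun ρ => p ρ * ρ) (Ioo 0 a) := by
  have := (integrableOn_fun_norm_addHaar volume).1 hp.force_finite
  simpa [mul_comm] using this

/-- The contact equation in terms of the half-space kernel: the auxiliary function is the
Newtonian potential of the pressure. -/
lemma IsContactPressure.potential {L : ℝ → ℝ} {θ h w a : ℝ} {Φ p : ℝ → ℝ}
    (hp : IsContactPressure L θ h Φ w a p) (hθ : 0 < θ) (hh : 0 < h) (ha : 0 < a)
    (hL0 : IntegrableOn (fun u => 1 - L u) (Ioi (0 : ℝ)))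
    {x : EuclideanSpace ℝ (Fin 2)} (hx : x ∈ Metric.ball 0 a) :
    IntegrableOn (fun y => p ‖y‖ / ‖x - y‖) (Metric.ball 0 a) ∧
      auxV L θ h Φ w a p ‖x‖ = ∫ y in Metric.ball 0 a, p ‖y‖ / ‖x - y‖ := by
  have hpi := Real.pi_pos
  have hc := continuous_layerF hL0
  have hF : IntegrableOn (fun y => layerF L (‖x - y‖ / h) * p ‖y‖) (Metric.ball 0 a) :=
    hp.force_finite.bdd_mul (c := ∫ u in Ioi (0 : ℝ), |1 - L u|)
      (by fun_prop : Continuous fun y : EuclideanSpace ℝ (Fin 2) =>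
        layerF L (‖x - y‖ / h)).aestronglyMeasurable
      (Filter.Eventually.of_forall fun y => abs_layerF_le hL0 _)
  -- Valid also at `y = x`, where `1 / 0 = 0` on both sides.
  have e (y : EuclideanSpace ℝ (Fin 2)) : p ‖y‖ / ‖x - y‖ =
      2 * Real.pi * θ * (influence L θ h (x - y) * p ‖y‖) +
        1 / h * (layerF L (‖x - y‖ / h) * p ‖y‖) := by
    rw [influence]
    field_simp
    ring
  simp_rw [e]
  have h1 := (hp.convergent x hx).const_mul (2 * Real.pi * θ)
  have h2 := hF.const_mul (1 / h)
  refine ⟨h1.add h2, ?_⟩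
  rw [integral_add h1 h2, integral_const_mul, integral_const_mul, hp.contact_eq x hx,
    integral_ball_layerF hL0 hh ha hp.integrableOn_mul_self, auxV]
  ring

end LayerContact

/-! ### Assembly of the theorem. -/

open LayerContact in
theorem mainTheorem1 (L : ℝ → ℝ) (θ h a b w : ℝ) (Φ p : ℝ → ℝ)
    (hθ : 0 < θ) (hh : 0 < h) (ha : 0 < a) (hab : a < b)
    (hL0 : IntegrableOn (fun u => 1 - L u) (Ioi (0 : ℝ)))
    (hL1 : IntegrableOn (fun u => (1 - L u) * u) (Ioi (0 : ℝ)))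
    (hΦ0 : Φ 0 = 0)
    (hΦ : ConvexOn ℝ (Metric.ball (0 : EuclideanSpace ℝ (Fin 2)) b) (fun x => Φ ‖x‖))
    (hp : LayerContact.IsContactPressure L θ h Φ w a p) :
    (IntervalIntegrable
        (fun s => deriv (LayerContact.auxV L θ h Φ w a p) s / √(a ^ 2 - s ^ 2)) volume 0 a ∧
      LayerContact.calV L θ h Φ w a p a = 0) ∧
    IntervalIntegrable (fun ρ => deriv Φ ρ / √(a ^ 2 - ρ ^ 2)) volume 0 a ∧
    IntervalIntegrable
      (fun ρ => LayerContact.S0 L (ρ / h) (a / h) * p ρ * ρ) volume 0 a ∧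
    w = a * (∫ ρ in (0 : ℝ)..a, deriv Φ ρ / √(a ^ 2 - ρ ^ 2)) -
      1 / (θ * h) * ∫ ρ in (0 : ℝ)..a, LayerContact.S0 L (ρ / h) (a / h) * p ρ * ρ := by
  have hg := hp.integrableOn_mul_self
  obtain ⟨c, hac, C, hC⟩ := exists_lipschitzOnWith_profile hab hΦ
  -- The Abel lemmas require a Lipschitz function on all of `ℝ`. The extension agrees with `Φ` on
  -- `[0, c)` with `c > a`, so values and derivatives on `(0, a)` are unchanged.
  obtain ⟨Ψ, hΨ, hΦΨ⟩ := hC.extend_real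
  obtain ⟨C', hK⟩ := exists_lipschitzWith_layerTerm (h := h) ha hL0 hL1 hg
  have hKd := differentiable_layerTerm (h := h) ha hL0 hL1 hg
  set K := layerTerm L h a p with hKdef
  set V : ℝ → ℝ := fun r => 2 * Real.pi * (θ * (w - Ψ r) + 1 / h * K r) with hVdef
  have hpi := Real.pi_pos
  have hVL : LipschitzWith (‖2 * Real.pi‖₊ * (‖θ‖₊ * (0 + C) + ‖1 / h‖₊ * C')) V :=
    (lipschitzWith_smul (2 * Real.pi)).comp
      (((lipschitzWith_smul θ).comp ((LipschitzWith.const w).sub hΨ)).add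
        ((lipschitzWith_smul (1 / h)).comp hK))
  have hVeq : EqOn (auxV L θ h Φ w a p) V (Ico 0 c) := fun r hr => by
    simp only [hVdef, hKdef, auxV, layerTerm, hΦΨ hr]
  have hmem {t : ℝ} (ht : t ∈ Ioo 0 (Real.pi / 2)) : a * Real.sin t ∈ Ioo 0 a :=
    image_mul_sin_Ioo ha ▸ mem_image_of_mem _ ht
  have hnhds {t : ℝ} (ht : t ∈ Ioo 0 (Real.pi / 2)) : Ico 0 c ∈ nhds (a * Real.sin t) :=
    Filter.mem_of_superset (isOpen_Ioo.mem_nhds ⟨(hmem ht).1, (hmem ht).2.trans hac⟩)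
      Ioo_subset_Ico_self
  have hdV : ∀ t ∈ Ioo 0 (Real.pi / 2),
      deriv (auxV L θ h Φ w a p) (a * Real.sin t) = deriv V (a * Real.sin t) := fun t ht =>
    (Filter.eventuallyEq_of_mem (hnhds ht) hVeq).deriv_eq
  have hdΦ : ∀ t ∈ Ioo 0 (Real.pi / 2),
      deriv Φ (a * Real.sin t) = deriv Ψ (a * Real.sin t) := fun t ht =>
    (Filter.eventuallyEq_of_mem (hnhds ht) hΦΨ).deriv_eq
  have hpi2 : (0 : ℝ) ≤ Real.pi / 2 := by positivity
  have hint_congr {f g : ℝ → ℝ} (hfg : ∀ t ∈ Ioo 0 (Real.pi / 2), f t = g t) :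
      ∫ t in (0 : ℝ)..(Real.pi / 2), f t = ∫ t in (0 : ℝ)..(Real.pi / 2), g t := by
    rw [intervalIntegral.integral_of_le hpi2, intervalIntegral.integral_of_le hpi2,
      integral_Ioc_eq_integral_Ioo, integral_Ioc_eq_integral_Ioo]
    exact setIntegral_congr_fun measurableSet_Ioo hfg
  have hint_of {f V : ℝ → ℝ} {D : NNReal} (hV : LipschitzWith D V)
      (hfg : ∀ t ∈ Ioo 0 (Real.pi / 2), f (a * Real.sin t) = deriv V (a * Real.sin t)) :
      IntervalIntegrable (fun s => f s / √(a ^ 2 - s ^ 2)) volume 0 a := by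
    rw [intervalIntegrable_div_sqrt_sq_sub_sq ha,
      intervalIntegrable_iff_integrableOn_Ioo_of_le hpi2]
    refine IntegrableOn.congr_fun ?_ (fun t ht => (hfg t ht).symm) measurableSet_Ioo
    simpa using (intervalIntegrable_iff_integrableOn_Ioo_of_le hpi2).1
      (intervalIntegrable_mul_deriv_comp_mul_sin hV (g := fun _ => 1) (a := a)
        continuous_const 0 (Real.pi / 2))
  have hzero : V 0 + a * ∫ t in (0 : ℝ)..(Real.pi / 2), deriv V (a * Real.sin t) = 0 := by
    refine abel_deriv_eq_zero hVL ha hp.force_finite hp.pos hp.edge_zero hp.edge_continuous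
      (fun x hx => (hp.potential hθ hh ha hL0 hx).1) fun x hx => ?_
    rw [← (hp.potential hθ hh ha hL0 hx).2]
    exact (hVeq ⟨norm_nonneg x, (mem_ball_zero_iff.1 hx).trans hac⟩).symm
  have h0 : (0 : ℝ) ∈ Ico 0 c := ⟨le_rfl, ha.trans hac⟩
  have hS : IntervalIntegrable (fun ρ => S0 L (ρ / h) (a / h) * p ρ * ρ) volume 0 a := by
    rw [intervalIntegrable_iff_integrableOn_Ioo_of_le ha.le]
    simp_rw [mul_assoc]
    exact hg.bdd_mul (c := ∫ u in Ioi (0 : ℝ), |1 - L u|)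
      (((continuous_S0 hL0 (a / h)).comp (continuous_id.div_const h)).aestronglyMeasurable)
      (Filter.Eventually.of_forall fun ρ => abs_S0_le hL0 _ _)
  refine ⟨⟨hint_of hVL hdV, ?_⟩, hint_of hΨ hdΦ, hS, ?_⟩
  · rw [calV, integral_div_sqrt_sq_sub_sq ha, hint_congr hdV, hVeq h0, hzero, mul_zero]
  · rw [integral_div_sqrt_sq_sub_sq ha, hint_congr hdΦ,
      ← abel_layerTerm (h := h) ha hL0 hL1 hg, ← hKdef]
    have hΨi : IntervalIntegrable (fun t => deriv Ψ (a * Real.sin t)) volume 0 (Real.pi / 2) := by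
      simpa using intervalIntegrable_mul_deriv_comp_mul_sin hΨ (g := fun _ => 1) (a := a)
        continuous_const 0 (Real.pi / 2)
    have hKi : IntervalIntegrable (fun t => deriv K (a * Real.sin t)) volume 0 (Real.pi / 2) := by
      simpa using intervalIntegrable_mul_deriv_comp_mul_sin hK (g := fun _ => 1) (a := a)
        continuous_const 0 (Real.pi / 2)
    -- Linearity of the derivative, available at almost every `t`, where `Ψ` is differentiable.
    have hsplit : ∫ t in (0 : ℝ)..(Real.pi / 2), deriv V (a * Real.sin t) =
        2 * Real.pi * (1 / h * (∫ t in (0 : ℝ)..(Real.pi / 2), deriv K (a * Real.sin t)) -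
          θ * ∫ t in (0 : ℝ)..(Real.pi / 2), deriv Ψ (a * Real.sin t)) := by
      rw [← intervalIntegral.integral_const_mul (1 / h), ← intervalIntegral.integral_const_mul θ,
        ← intervalIntegral.integral_sub (hKi.const_mul _) (hΨi.const_mul _),
        ← intervalIntegral.integral_const_mul]
      refine intervalIntegral.integral_congr_ae ?_
      filter_upwards [ae_hasDerivAt_comp_mul_sin hΨ ha] with t ht hm
      rw [uIoc_of_le hpi2] at hm
      have h1 := ((((ht hm).const_sub w).const_mul θ).add
        ((hKd (a * Real.sin t)).hasDerivAt.const_mul (1 / h))).const_mul (2 * Real.pi)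
      have h2 : HasDerivAt V _ (a * Real.sin t) := h1
      rw [h2.deriv]
      ring
    have hV0 : V 0 = 2 * Real.pi * (θ * w + 1 / h * K 0) := by
      simp only [hVdef, ← hΦΨ h0, hΦ0, sub_zero]
    rw [hsplit, hV0] at hzero
    set I := ∫ t in (0 : ℝ)..(Real.pi / 2), deriv K (a * Real.sin t)
    set J := ∫ t in (0 : ℝ)..(Real.pi / 2), deriv Ψ (a * Real.sin t)
    have h3 : 2 * Real.pi * (θ * w + 1 / h * K 0 + a * (1 / h * I - θ * J)) = 0 := by
      linear_combination hzero
    have h4 := (mul_eq_zero.1 h3).resolve_left (by positivity)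
    field_simp at h4 ⊢
    linarith
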